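/- **Protocol.** There are $T\ge 1$ threads. The slot with index $k=iT+\tau$ ($0\le\tau<T$) belongs to thread $\tau$ and occurs at time $k\,t_0/T=i\,t_0+\tau t_0/T$, $t_0>0$. Each thread has a genesis block (slot number $i=0$, no parents). Any other block $b$ in thread $\tau$ carries a slot number $i$, one parent $P(b,\sigma)$ in each thread $\sigma$, a number $e\le E$ of endorsements, and a content of fewer than $S_B$ bits ($S_B\ge1$); blocks are identified with what they carry. It is *valid* if its parents are valid and pairwise compatible, its slot number exceeds that of its parent in its own thread, and every ancestor of it in a thread $\sigma$ is $P(b,\sigma)$ or an ancestor of $P(b,\sigma)$. The fitness of a block is $1+e$ ($1$ for genesis blocks), the fitness of a set is the sum over its blocks. *Compatibility.* Two distinct blocks $a,b$ in threads $\tau_1,\tau_2$ are *incompatible* if (i) neither is a genesis block, $\tau_1=\tau_2$ and $P(a,\tau_1)=P(b,\tau_1)$; or (ii) neither is a genesis block, $P(a,\tau_1)$ is not equal to or an ancestor within thread $\tau_1$ of $P(b,\tau_1)$, and $P(b,\tau_2)$ is not equal to or an ancestor within thread $\tau_2$ of $P(a,\tau_2)$; or (iii) one of them is (recursively) incompatible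 with a parent of the other. Two sets of blocks are compatible if no block of one is incompatible with a block of the other. *Consensus rule.* A node sorts the blocks it has processed into final, stale and unsettled ones; at first just the genesis blocks are known, and they are unsettled. A new block with a stale parent, or incompatible with a final block, is stale. Any other new block joins the unsettled blocks. Then every unsettled block is made stale for which all cliques (maximal sets of mutually compatible unsettled blocks) that contain it have a fitness lower than the maximum fitness of a clique minus $F(E+1)$. Next, among the cliques of the remaining unsettled blocks, every block is made final that is in all cliques and has, in at least one of them, descendants of total fitness greater than $F(E+1)$. The *blockclique* of a node consists of its final blocks and an unsettled clique of maximum fitness. **Network and selection.** There are finitely many nodes, honest or Byzantine. For each slot one node is drawn, independently of the other slots and in the same way for all cliques, from the current distribution of the resource among the nodes; the Byzantine nodes always hold a proportion at most $\beta\ge 0$ of it. A selected honest node misses its slot with probability $\mu$, independently. Put $\gamma=(1-\beta)(1-\mu)$. **Executions (worst-case attack model).** Honest nodes process valid blocks only, each once, after its parents and not before the time of its slot. A selected Byzantine node may create any number of blocks in its slot, with any content and parents, at any time; each of them may be shown to any honest nodes at any times, or to none. A selected honest node that does not miss its slot creates exactly one block. As long as no attack has succeeded at an earlier time, honest nodes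 are absent from attack cliques and extend the honest clique: the parent of the new block in each thread is the last honest block of an earlier slot of that thread known to its producer (the genesis block if there is none), and the block is known to its producer at once and to every honest node after a delay of at most $\delta$, where $\delta\ge0$. *An attack has succeeded at time $u$* if at time $u$ some honest node has discarded a block of an honest node as stale, or a block final for some honest node is incompatible with a block of a blockclique of some honest node. After an attack has succeeded, honest nodes may create arbitrary blocks. All choices left open, including the delays, are made by the attacker, who may know all selection results in advance. **Theorem (Consistency).** Let $T\ge1$, and let $\beta,\mu$ satisfy $\beta<\gamma$. There are constants $C,c>0$, depending only on $T,\beta,\mu$, such that for all $t_0,S_B,F$, all networks as above with $\delta<t_0/2$, with $E=0$, all honest nodes $n_1,n_2$ and all $t,r>0$ the following holds. Let $\mathcal F_j^u$ be the set of final blocks observed by $n_j$ at time $u$. 1. Whatever the attacker does, the probability that $\mathcal F_1^t$ and $\mathcal F_2^t$ are compatible but $\mathcal F_1^{t+r}$ and $\mathcal F_2^{t+r}$ are not is at most $C\left(\left\lfloor\frac{(t+r)T}{t_0}\right\rfloor+1\right)e^{-cF}$. 2. The probability that $\mathcal F_1^t$ and $\mathcal F_2^t$ are compatible, no attack has succeeded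 up to time $t$, and $\mathcal F_1^{t+r}$ and $\mathcal F_2^{t+r}$ are not compatible is at most $C\left(\left\lfloor\frac{rT}{t_0}\right\rfloor+1\right)e^{-cF}$. (Probabilities are outer probabilities of the set of selection outcomes for which the attacker has a choice of his actions that leads to the event.) -/

import Mathlib

namespace Blockclique

/-! ### Blocks and the multithreaded block DAG -/

/-- Blocks with `T` threads. A non-genesis block in thread `τ` and block slot `s_i^τ` carries one
parent per thread, the number `e` of its endorsements, and its remaining content (transactions),
a bit string. Blocks are identified with what they contain, i.e. hashes do not collide; in
particular the parent graph has no cycles. -/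
inductive Block (T : ℕ) : Type
  | genesis (τ : Fin T) : Block T
  | mk (τ : Fin T) (i : ℕ) (parents : Fin T → Block T) (e : ℕ) (content : List Bool) : Block T

namespace Block

variable {T : ℕ}

/-- The thread of a block. -/
def thread : Block T → Fin T
  | genesis τ => τ
  | mk τ _ _ _ _ => τ

/-- The number `i` of the slot `s_i^τ` of a block in its thread; genesis blocks are in slot `0`. -/
def num : Block T → ℕ
  | genesis _ => 0
  | mk _ i _ _ _ => i

/-- The slots of all threads in their order of time: `s_i^τ` is the slot with index `i T + τ`. -/
def slot (b : Block T) : ℕ := b.num * T + b.thread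

/-- `P(b, τ)`, the parent of `b` in thread `τ`; genesis blocks have none. -/
def parent : Block T → Fin T → Option (Block T)
  | genesis _, _ => none
  | mk _ _ ps _ _, τ => some (ps τ)

/-- The fitness `1 + e` of a block. -/
def fitness : Block T → ℕ
  | genesis _ => 1
  | mk _ _ _ e _ => 1 + e

/-- `a.Anc b`: `a` is a (strict) ancestor of `b` in the block graph. -/
def Anc : Block T → Block T → Prop :=
  Relation.TransGen fun p b => ∃ τ, b.parent τ = some p

/-- `Path_τ(a, b)`: `a = b`, or a path of the block graph leads from `a` to `b` through blocks of
thread `τ` only. -/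
def Path (τ : Fin T) : Block T → Block T → Prop :=
  Relation.ReflTransGen fun p b => p.thread = τ ∧ b.thread = τ ∧ b.parent τ = some p

/-- Thread incompatibility: two non-genesis blocks of one thread with the same parent in it. -/
def TI (a b : Block T) : Prop :=
  a.thread = b.thread ∧
    ∃ p, a.parent a.thread = some p ∧ b.parent b.thread = some p

/-- Grandpa incompatibility: `a` and `b` are non-genesis blocks, there is no path from `P(a, τ₁)`
to `P(b, τ₁)` in the thread `τ₁` of `a`, and none from `P(b, τ₂)` to `P(a, τ₂)` in the thread
`τ₂` of `b`. -/
def GPI (a b : Block T) : Prop :=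
  ∃ p₁ q₁ p₂ q₂,
    a.parent a.thread = some p₁ ∧ b.parent a.thread = some q₁ ∧
    b.parent b.thread = some p₂ ∧ a.parent b.thread = some q₂ ∧
    ¬ Path a.thread p₁ q₁ ∧ ¬ Path b.thread p₂ q₂

/-- Incompatibility of two distinct blocks: they are thread or grandpa incompatible, or one of them
is incompatible with a parent of the other. This is the complement of the recursively defined
compatibility graph, see `compat_iff`; the recursion goes down the block graph, so it has only one
solution. -/
inductive Incompat : Block T → Block T → Prop
  | ti {a b : Block T} : a ≠ b → TI a b → Incompat a b
  | gpi {a b : Block T} : a ≠ b → GPI a b → Incompat a b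
  | left {a b p : Block T} (τ : Fin T) :
      a ≠ b → a.parent τ = some p → Incompat p b → Incompat a b
  | right {a b p : Block T} (τ : Fin T) :
      a ≠ b → b.parent τ = some p → Incompat a p → Incompat a b

/-- Compatibility of blocks (a block is compatible with itself). -/
def Compat (a b : Block T) : Prop := ¬ Incompat a b

/-- The recursive description of the compatibility graph. -/
theorem compat_iff (a b : Block T) :
    Compat a b ↔ a = b ∨
      (¬ TI a b ∧ ¬ GPI a b ∧ (∀ τ p, b.parent τ = some p → Compat a p) ∧
        (∀ τ p, a.parent τ = some p → Compat p b)) := by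
  constructor
  · intro h
    by_cases hab : a = b
    · exact Or.inl hab
    · exact Or.inr ⟨fun h' => h (.ti hab h'), fun h' => h (.gpi hab h'),
        fun τ p hp h' => h (.right τ hab hp h'), fun τ p hp h' => h (.left τ hab hp h')⟩
  · rintro (rfl | ⟨h1, h2, h3, h4⟩) h
    · cases h <;> contradiction
    · cases h with
      | ti _ h => exact h1 h
      | gpi _ h => exact h2 h
      | left τ _ hp h => exact h4 τ _ hp h
      | right τ _ hp h => exact h3 τ _ hp h

end Block

/-- Parameters of the protocol with `T` threads: time `t₀` between two slots of a thread, maximal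
block size `SB`, number `E` of endorsement slots of a block, finality parameter `F`. -/
structure Params (T : ℕ) where
  t₀ : ℝ
  SB : ℕ
  E : ℕ
  F : ℕ

variable {T : ℕ}

/-- The time at which the slot with index `k` occurs: `i t₀ + τ t₀ / T` for `k = i T + τ`. -/
noncomputable def Params.slotTime (P : Params T) (k : ℕ) : ℝ := k * P.t₀ / T

/-- The fitness threshold `Δ_f⁰ = F (E + 1)`. -/
def Params.threshold (P : Params T) : ℕ := P.F * (P.E + 1)

/-- Valid blocks: the rules of a multithreaded block DAG; the parents are mutually compatible. -/
inductive Valid (P : Params T) : Block T → Prop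
  | genesis (τ : Fin T) : Valid P (.genesis τ)
  | mk (τ : Fin T) (i : ℕ) (ps : Fin T → Block T) (e : ℕ) (content : List Bool) :
      (∀ σ, Valid P (ps σ)) →
      (∀ σ, (ps σ).thread = σ) →
      (ps τ).num < i →
      (∀ a, Block.Anc a (.mk τ i ps e content) →
        a = ps a.thread ∨ Block.Anc a (ps a.thread)) →
      (∀ σ σ', Block.Compat (ps σ) (ps σ')) →
      e ≤ P.E →
      content.length < P.SB →
      Valid P (.mk τ i ps e content)

/-! ### The consensus rule -/

section Consensus

open Classical

/-- Total fitness of a set of blocks. -/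
def fit (C : Finset (Block T)) : ℕ := ∑ b ∈ C, b.fitness

/-- `C` is a clique: a maximal set of mutually compatible blocks among the blocks of `S`. -/
def IsClique (S C : Finset (Block T)) : Prop :=
  Maximal (fun D : Finset (Block T) => D ⊆ S ∧ ∀ a ∈ D, ∀ b ∈ D, Block.Compat a b) C

/-- `C` is a clique of maximum total fitness among the blocks of `S`. -/
def IsBest (S C : Finset (Block T)) : Prop :=
  IsClique S C ∧ ∀ D, IsClique S D → fit D ≤ fit C

/-- `b` is only in cliques of `S` with a fitness lower than the best one minus the threshold. -/
def StaleIn (P : Params T) (S : Finset (Block T)) (b : Block T) : Prop :=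
  ∀ C, IsClique S C → b ∈ C → ∃ B, IsBest S B ∧ fit C + P.threshold < fit B

/-- `b` is in all cliques of `S`, and in one of them its descendants cumulate a total fitness
greater than the threshold. -/
def FinalIn (P : Params T) (S : Finset (Block T)) (b : Block T) : Prop :=
  (∀ C, IsClique S C → b ∈ C) ∧
    ∃ C, IsClique S C ∧ b ∈ C ∧ P.threshold < fit {d ∈ C | Block.Anc b d}

/-- What a node knows: its final blocks, its stale blocks, and the blocks of the incremental
compatibility graph (`head`), which are not settled yet. -/
structure NodeState (T : ℕ) where
  final : Finset (Block T)
  stale : Finset (Block T)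
  head : Finset (Block T)

/-- At first the incremental compatibility graph consists of the genesis blocks. -/
noncomputable def NodeState.init : NodeState T where
  final := ∅
  stale := ∅
  head := Finset.univ.image Block.genesis

/-- Processing of a new block `b`. It is stale if it refers to a stale parent or is incompatible
with a final block. Otherwise it enters the incremental compatibility graph, from which then first
the stale and next the final blocks are removed. -/
noncomputable def NodeState.step (P : Params T) (s : NodeState T) (b : Block T) : NodeState T :=
  if (∃ τ p, b.parent τ = some p ∧ p ∈ s.stale) ∨ ∃ f ∈ s.final, Block.Incompat f b then
    { s with stale := insert b s.stale }
  else
    let H₁ := insert b s.head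
    let H₂ := {x ∈ H₁ | ¬ StaleIn P H₁ x}
    { final := s.final ∪ {x ∈ H₂ | FinalIn P H₂ x}
      stale := s.stale ∪ {x ∈ H₁ | StaleIn P H₁ x}
      head := {x ∈ H₂ | ¬ FinalIn P H₂ x} }

/-- The state of a node that has processed the blocks of the list `l` one after the other. -/
noncomputable def nodeState (P : Params T) (l : List (Block T)) : NodeState T :=
  l.foldl (NodeState.step P) NodeState.init

/-- The blocks of the blockclique in a state: the final blocks and those in a best clique. -/
def NodeState.InBlockclique (s : NodeState T) (b : Block T) : Prop :=
  b ∈ s.final ∨ ∃ C, IsBest s.head C ∧ b ∈ C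

end Consensus

/-! ### The network and the random selection -/

/-- A network with set of nodes `N`: the Byzantine nodes, the proportions of the resource held by
the nodes at each slot, the probability `μ` with which a selected honest node misses the creation
of its block, and the maximal propagation delay `δ`. -/
structure Network (N : Type*) where
  byz : Set N
  resource : ℕ → PMF N
  μ : unitInterval
  δ : ℝ

variable {N : Type*}

/-- The law of the selection: `ω k = (n, m)` says that node `n` is selected for the slot with
index `k`, and `m` whether it misses block creation in case it is honest. The choices are
independent, `n` is drawn from the resource distribution, and `m` is `true` with probability
`μ`. -/
noncomputable def Network.selection [MeasurableSpace N] (W : Network N) :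
    MeasureTheory.Measure (ℕ → N × Bool) :=
  MeasureTheory.Measure.infinitePi fun k =>
    ((W.resource k).toMeasure).prod (ProbabilityTheory.bernoulliMeasure true false W.μ)

/-- The slot with index `k` (not one of the `T` genesis slots) is used by an honest node. -/
def HonestSlot (T : ℕ) (W : Network N) (ω : ℕ → N × Bool) (k : ℕ) : Prop :=
  T ≤ k ∧ (ω k).1 ∉ W.byz ∧ (ω k).2 = false

/-- What happens in the network: `log n u` lists the blocks processed by node `n` until time `u`,
in their order of processing, and `honestBlock k` is the block created by the honest node selected
for the slot `k` (of no meaning if there is none). -/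
structure Trace (T : ℕ) (N : Type*) where
  log : N → ℝ → List (Block T)
  honestBlock : ℕ → Block T

namespace Trace

/-- The state of node `n` at time `u`. -/
noncomputable def state (P : Params T) (X : Trace T N) (n : N) (u : ℝ) : NodeState T :=
  nodeState P (X.log n u)

/-- The set of final blocks observed by node `n` at time `u`. -/
noncomputable def finals (P : Params T) (X : Trace T N) (n : N) (u : ℝ) : Set (Block T) :=
  ↑(X.state P n u).final

/-- The sets of final blocks observed by `n₁` and `n₂` at time `u` are compatible. -/
def FinalsCompat (P : Params T) (X : Trace T N) (n₁ n₂ : N) (u : ℝ) : Prop :=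
  ∀ b₁ ∈ X.finals P n₁ u, ∀ b₂ ∈ X.finals P n₂ u, Block.Compat b₁ b₂

/-- An attack has succeeded, as seen at time `u`: an honest node has discarded a block of an
honest node as stale, or the blockclique of an honest node has a block incompatible with a block
that is final for an honest node. -/
def AttackSuccess (P : Params T) (W : Network N) (ω : ℕ → N × Bool) (X : Trace T N) (u : ℝ) :
    Prop :=
  (∃ n, n ∉ W.byz ∧ ∃ b ∈ (X.state P n u).stale, HonestSlot T W ω b.slot) ∨
  (∃ n n', n ∉ W.byz ∧ n' ∉ W.byz ∧ ∃ b ∈ X.finals P n u, ∃ b',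
    (X.state P n' u).InBlockclique b' ∧ Block.Incompat b b')

/-- `p` is the last block of thread `σ` among the genesis blocks and the blocks of honest nodes
that node `n` has processed until the time of slot `k`, a block of slot `k` itself excepted. -/
def IsTip (P : Params T) (W : Network N) (ω : ℕ → N × Bool) (X : Trace T N) (n : N) (k : ℕ)
    (σ : Fin T) (p : Block T) : Prop :=
  let known : Set (Block T) := {b | b.thread = σ ∧ (b = Block.genesis σ ∨
    (b ∈ X.log n (P.slotTime k) ∧ HonestSlot T W ω b.slot ∧ b.slot < k))}
  p ∈ known ∧ ∀ b ∈ known, b.slot ≤ p.slot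

/-- The block of slot `k` is one that honest nodes create when they extend their clique: its parent
in each thread is the last block of honest nodes known to its producer. -/
def ExtendsHonestClique (P : Params T) (W : Network N) (ω : ℕ → N × Bool) (X : Trace T N)
    (k : ℕ) : Prop :=
  ∃ (τ : Fin T) (i : ℕ) (ps : Fin T → Block T) (e : ℕ) (content : List Bool),
    k = i * T + τ ∧ X.honestBlock k = .mk τ i ps e content ∧
    e ≤ P.E ∧ content.length < P.SB ∧ ∀ σ, X.IsTip P W ω (ω k).1 k σ (ps σ)

/-- The executions that are possible for the outcome `ω` of the selection, under attack by the
Byzantine nodes. Everything that is not prescribed here is chosen by the attacker: the number,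
parents, contents and creation times of the blocks of Byzantine nodes, to which honest nodes and
when they are shown, and the delays of the blocks of honest nodes (up to `δ`). -/
structure Admissible (P : Params T) (W : Network N) (ω : ℕ → N × Bool) (X : Trace T N) :
    Prop where
  /-- Nodes only append to their log. -/
  log_mono : ∀ n, n ∉ W.byz → ∀ u v, u ≤ v → X.log n u <+: X.log n v
  log_nodup : ∀ n, n ∉ W.byz → ∀ u, (X.log n u).Nodup
  /-- Only valid blocks are processed. The genesis blocks are known from the start. -/
  log_valid : ∀ n, n ∉ W.byz → ∀ u, ∀ b ∈ X.log n u, Valid P b ∧ ∀ τ, b ≠ .genesis τ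
  /-- A block is processed after its parents. -/
  log_parents : ∀ n, n ∉ W.byz → ∀ u l₁ b l₂, X.log n u = l₁ ++ b :: l₂ →
    ∀ τ p, b.parent τ = some p → p ∈ l₁ ∨ ∃ σ, p = .genesis σ
  /-- No block is accepted before its slot occurs. -/
  log_time : ∀ n, n ∉ W.byz → ∀ u, ∀ b ∈ X.log n u, P.slotTime b.slot ≤ u
  /-- A block is created by the node selected for its slot. Byzantine nodes may create any number of
  blocks in a slot; honest nodes create one, and none if they miss the slot. -/
  log_selected : ∀ n, n ∉ W.byz → ∀ u, ∀ b ∈ X.log n u,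
    (ω b.slot).1 ∈ W.byz ∨ (HonestSlot T W ω b.slot ∧ b = X.honestBlock b.slot)
  /-- As long as no attack has succeeded, honest nodes extend the honest clique, -/
  honest_create : ∀ k, HonestSlot T W ω k →
    (∀ u, u < P.slotTime k → ¬ X.AttackSuccess P W ω u) → X.ExtendsHonestClique P W ω k
  /-- and their blocks are known to all honest nodes after the delay `δ` (to their producer at
  once). -/
  honest_delivery : ∀ k, HonestSlot T W ω k →
    (∀ u, u < P.slotTime k → ¬ X.AttackSuccess P W ω u) →
    ∀ n, n ∉ W.byz → ∀ u,
      (P.slotTime k + W.δ ≤ u ∨ n = (ω k).1 ∧ P.slotTime k ≤ u) → X.honestBlock k ∈ X.log n u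

end Trace

end Blockclique

/-! Incompatible final blocks of two honest nodes are themselves a successful attack, so it suffices
to study the slot interval `m` in which an attack first succeeds. Up to slot `m` the honest blocks
are mutually compatible (`HonestChain.compat`), and each of them is known to all honest nodes one
period, i.e. `T` slots, later.

The core is deterministic: success in interval `m` forces `Bad`. There are then final segments of
the threads, of total length at least about F/(6T), whose honest slots outnumber their Byzantine
slots by at most 6T. Compatible valid blocks of one slot coincide (`Valid.eq_of_compat_of_slot_eq`),
so for E = 0 the fitness of a clique is a number of distinct slots. A compatible set that leaves the
honest chain in some thread excludes all later honest blocks of that thread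
(`HonestChain.not_compat`). Hence a clique that competes with the honest blocks yields such
segments, starting in each thread at its first foreign block (`HonestChain.exists_slotsFrom`). The
possible failures are a foreign block becoming final (`HonestLog.bad_of_final_notMem`), an honest
block becoming stale (`HonestLog.bad_of_mem_stale_step`), and a blockclique in conflict with a final
block (`HonestLog.bad_of_incompat_final`).

The probability of `Bad` is bounded by an exponential moment: a Byzantine slot counts x, a used
honest slot 1/x. As β < γ, some x > 1 has mean at most ρ < 1 per slot, and Markov's inequality gives
a bound of order ρ^n for fixed segments of total length n. Summing over the starting points gives a
product of `T` geometric series, bounded independently of `m` (`exists_measure_bad_le`). A union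
bound over the possible `m` yields the factors in front of the exponential. -/

namespace Blockclique
variable {T : ℕ} {P : Params T}

/-! ### Symmetry of incompatibility, slots and paths. -/

namespace Block

theorem TI.symm {a b : Block T} (h : TI a b) : TI b a := by
  obtain ⟨h1, p, h2, h3⟩ := h
  exact ⟨h1.symm, p, h3, h2⟩

theorem GPI.symm {a b : Block T} (h : GPI a b) : GPI b a := by
  obtain ⟨p₁, q₁, p₂, q₂, h1, h2, h3, h4, h5, h6⟩ := h
  exact ⟨p₂, q₂, p₁, q₁, h3, h4, h1, h2, h6, h5⟩

theorem Incompat.ne {a b : Block T} (h : Incompat a b) : a ≠ b := by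
  cases h <;> assumption

theorem Incompat.symm {a b : Block T} (h : Incompat a b) : Incompat b a := by
  induction h with
  | ti hne h => exact .ti hne.symm h.symm
  | gpi hne h => exact .gpi hne.symm h.symm
  | left τ hne hp _ ih => exact .right τ hne.symm hp ih
  | right τ hne hp _ ih => exact .left τ hne.symm hp ih

theorem Compat.refl (a : Block T) : Compat a a := fun h => h.ne rfl

theorem Compat.symm {a b : Block T} (h : Compat a b) : Compat b a := fun h' => h h'.symm

/-- Genesis blocks have no parents, so only recursion on the side of `b` could produce an
incompatibility, and it never reaches a base case. -/
theorem genesis_compat (τ : Fin T) (b : Block T) : Compat (genesis τ) b := by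
  intro h
  generalize ha : genesis τ = a at h
  induction h with
  | ti hne h => subst ha; obtain ⟨_, p, h, _⟩ := h; simp [parent] at h
  | gpi hne h => subst ha; obtain ⟨p, _, _, _, h, _⟩ := h; simp [parent] at h
  | left τ hne hp _ ih => subst ha; simp [parent] at hp
  | right τ hne hp _ ih => exact ih ha

theorem slot_lt_iff_num {a b : Block T} (h : a.thread = b.thread) :
    a.slot < b.slot ↔ a.num < b.num := by
  have hT : 0 < T := a.thread.pos
  unfold slot
  rw [h, Nat.add_lt_add_iff_right, Nat.mul_lt_mul_right hT]

theorem slot_le_iff_num {a b : Block T} (h : a.thread = b.thread) :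
    a.slot ≤ b.slot ↔ a.num ≤ b.num := by
  have hT : 0 < T := a.thread.pos
  unfold slot
  rw [h, Nat.add_le_add_iff_right, Nat.mul_le_mul_right_iff hT]

theorem slot_mod (a : Block T) : a.slot % T = a.thread := by
  unfold slot
  rw [Nat.mul_comm, Nat.mul_add_mod, Nat.mod_eq_of_lt a.thread.2]

theorem thread_eq_of_slot_eq {a b : Block T} (h : a.slot = b.slot) : a.thread = b.thread := by
  apply Fin.ext
  rw [← slot_mod, ← slot_mod, h]

theorem num_eq_of_slot_eq {a b : Block T} (h : a.slot = b.slot) : a.num = b.num := by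
  have ht := thread_eq_of_slot_eq h
  exact le_antisymm ((slot_le_iff_num ht).1 h.le) ((slot_le_iff_num ht.symm).1 h.ge)

theorem Anc.trans {a b c : Block T} (h : Anc a b) (h' : Anc b c) : Anc a c :=
  Relation.TransGen.trans h h'

theorem anc_of_parent {p b : Block T} {τ : Fin T} (h : b.parent τ = some p) : Anc p b :=
  Relation.TransGen.single ⟨τ, h⟩

theorem Path.eq_or_anc {τ : Fin T} {a b : Block T} (h : Path τ a b) : a = b ∨ Anc a b := by
  induction h with
  | refl => exact Or.inl rfl
  | tail _ hs ih =>
    right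
    rcases ih with rfl | ih
    · exact anc_of_parent hs.2.2
    · exact ih.trans (anc_of_parent hs.2.2)

end Block

open Block

/-! ### Ancestry and compatibility of valid blocks. -/

namespace Valid

theorem parent {b p : Block T} {σ : Fin T} (hb : Valid P b) (h : b.parent σ = some p) :
    Valid P p ∧ p.thread = σ := by
  cases hb with
  | genesis τ => simp [Block.parent] at h
  | mk τ i ps e content h1 h2 =>
    simp only [Block.parent, Option.some.injEq] at h
    subst h
    exact ⟨h1 σ, h2 σ⟩

theorem parent_num_lt {b p : Block T} (hb : Valid P b) (h : b.parent b.thread = some p) :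
    p.num < b.num := by
  cases hb with
  | genesis τ => simp [Block.parent] at h
  | mk τ i ps e content h1 h2 h3 =>
    simp only [Block.parent, Option.some.injEq] at h
    subst h
    exact h3

theorem anc {a b : Block T} (hb : Valid P b) (h : Anc a b) : Valid P a := by
  induction h using Relation.TransGen.head_induction_on with
  | single h => exact (hb.parent h.choose_spec).1
  | head h _ ih => exact (ih.parent h.choose_spec).1

theorem path {a b : Block T} {τ : Fin T} (hb : Valid P b) (h : Path τ a b) : Valid P a := by
  rcases h.eq_or_anc with rfl | h
  exacts [hb, hb.anc h]

theorem fitness_eq (hE : P.E = 0) {b : Block T} (hb : Valid P b) : b.fitness = 1 := by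
  cases hb with
  | genesis τ => rfl
  | mk τ i ps e content h1 h2 h3 h4 h5 h6 => simp only [fitness]; omega

theorem num_pos {b : Block T} (hb : Valid P b) (h : ∀ τ, b ≠ .genesis τ) : 0 < b.num := by
  cases hb with
  | genesis τ => exact absurd rfl (h τ)
  | mk τ i ps e content h1 h2 h3 => exact lt_of_le_of_lt (Nat.zero_le _) h3

theorem exists_parent {b : Block T} (h : ∀ τ, b ≠ .genesis τ) (σ : Fin T) :
    ∃ p, b.parent σ = some p := by
  cases b with
  | genesis τ => exact absurd rfl (h τ)
  | mk τ i ps e content => exact ⟨_, rfl⟩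

theorem ne_genesis_of_anc {a b : Block T} (h : Anc a b) (τ : Fin T) : b ≠ .genesis τ := by
  rintro rfl
  obtain ⟨c, _, σ, h⟩ := Relation.TransGen.tail'_iff.1 h
  simp [Block.parent] at h

/-- An ancestor of a valid block is connected to the parent in its thread through that thread. -/
theorem path_parent_of_anc {b : Block T} (hb : Valid P b) :
    ∀ {a p : Block T}, Anc a b → b.parent a.thread = some p → Path a.thread a p := by
  induction hb with
  | genesis τ => intro a p _ h; simp [Block.parent] at h
  | mk τ i ps e content h1 h2 h3 h4 h5 h6 h7 ih =>
    intro a p ha h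
    simp only [Block.parent, Option.some.injEq] at h
    subst h
    rcases h4 a ha with h | h
    · nth_rewrite 2 [h]
      exact Relation.ReflTransGen.refl
    · obtain ⟨q, hq⟩ := exists_parent (ne_genesis_of_anc h) a.thread
      exact Relation.ReflTransGen.tail (ih a.thread h hq)
        ⟨((h1 _).parent hq).2, h2 _, hq⟩

theorem num_le_of_path {a b : Block T} {τ : Fin T} (hb : Valid P b) (h : Path τ a b) :
    a.num ≤ b.num := by
  induction h using Relation.ReflTransGen.head_induction_on with
  | refl => exact le_rfl
  | @head a c h h' ih =>
    refine le_trans (le_of_lt ((hb.path h').parent_num_lt (p := a) ?_)) ih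
    rw [h.2.1]; exact h.2.2

theorem num_lt_of_anc {a b : Block T} (hb : Valid P b) (h : Anc a b) (ht : a.thread = b.thread) :
    a.num < b.num := by
  obtain ⟨q, hq⟩ := exists_parent (ne_genesis_of_anc h) a.thread
  exact lt_of_le_of_lt ((hb.parent hq).1.num_le_of_path (hb.path_parent_of_anc h hq))
    (hb.parent_num_lt (ht ▸ hq))

theorem eq_of_path_of_num_eq {a b : Block T} {τ : Fin T} (hb : Valid P b) (h : Path τ a b)
    (ht : a.thread = b.thread) (hn : a.num = b.num) : a = b := by
  rcases h.eq_or_anc with h | h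
  · exact h
  · exact absurd hn (hb.num_lt_of_anc h ht).ne

/-- Incompatibility of a parent with `y` passes up to its child by the rule `left`, except when the
child is `y` itself; `hy` covers that case. -/
theorem compat_anc_of {x y a : Block T} (hy : ∀ a, Anc a y → Compat a y) (h : Compat x y)
    (ha : Anc a x) : Compat a y := by
  have step : ∀ {p z}, (∃ τ, z.parent τ = some p) → Compat z y → Compat p y := by
    rintro p z ⟨τ, hp⟩ hz
    by_cases hzy : z = y
    · subst hzy; exact hy p (anc_of_parent hp)
    · exact fun hi => hz (.left τ hzy hp hi)
  induction ha using Relation.TransGen.head_induction_on with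
  | single h' => exact step h' h
  | head h' _ ih => exact step h' ih

/-- Induction on `b`, and inside it on `a`. A common thread parent would have to lie both before `a`
and not before it; grandpa incompatibility is refuted by the path through `a` to the parent of `b`.
Parents of `a` fall under the inner induction. A parent of `b` is compatible with the parent of `b`
in the thread of `a`, hence with `a`, which is that parent or an ancestor of it. -/
theorem compat_of_anc {b : Block T} (hb : Valid P b) : ∀ a, Anc a b → Compat a b := by
  induction hb with
  | genesis τ => exact fun a h => absurd rfl (ne_genesis_of_anc h τ)
  | mk τ i ps e content h1 h2 h3 h4 h5 h6 h7 ih =>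
    have hb : Valid P (.mk τ i ps e content) := .mk τ i ps e content h1 h2 h3 h4 h5 h6 h7
    intro a ha
    induction a with
    | genesis σ => exact genesis_compat σ _
    | mk σ i' ps' e' content' iha =>
      intro hi
      have hpath := hb.path_parent_of_anc (a := .mk σ i' ps' e' content') ha rfl
      have hva := hb.anc ha
      cases hi with
      | ti hne h =>
        obtain ⟨ht, p, hp, hq⟩ := h
        have := hb.num_lt_of_anc ha ht
        have h8 := hb.path_parent_of_anc ha (p := p) (by rw [ht]; exact hq)
        have h9 := (hva.parent hp).1.num_le_of_path h8
        exact absurd (hva.parent_num_lt hp) (not_lt.2 h9)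
      | gpi hne h =>
        obtain ⟨p₁, q₁, p₂, q₂, hp, hq, _, _, h5, _⟩ := h
        apply h5
        refine Relation.ReflTransGen.head ⟨(hva.parent hp).2, rfl, hp⟩
          (hb.path_parent_of_anc ha hq)
      | left σ' hne hp h =>
        simp only [Block.parent, Option.some.injEq] at hp
        subst hp
        exact iha σ' ((anc_of_parent (b := .mk σ i' ps' e' content') rfl).trans ha) h
      | right σ' hne hp h =>
        simp only [Block.parent, Option.some.injEq] at hp
        subst hp
        rcases h4 _ ha with h8 | h8
        · rw [h8] at h
          exact h5 _ _ h
        · exact compat_anc_of (ih σ') (h5 _ _) h8 h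

theorem compat_anc {x y a : Block T} (hy : Valid P y) (h : Compat x y) (ha : Anc a x) :
    Compat a y := compat_anc_of hy.compat_of_anc h ha

theorem genesis_path {b : Block T} (hb : Valid P b) : Path b.thread (.genesis b.thread) b := by
  induction hb with
  | genesis τ => exact Relation.ReflTransGen.refl
  | mk τ i ps e content h1 h2 h3 h4 h5 h6 h7 ih =>
    have := ih τ
    rw [h2] at this
    exact Relation.ReflTransGen.tail this ⟨h2 τ, rfl, rfl⟩

/-- The block that follows `p` on the way to `b` has the same thread parent as `a` and is compatible
with it, so it must be `a`. -/
theorem path_of_path_parent {a b p q : Block T} (ha : Valid P a) (hb : Valid P b)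
    (ht : a.thread = b.thread) (h : Compat a b)
    (hp : a.parent a.thread = some p) (hq : b.parent b.thread = some q)
    (hpq : Path a.thread p q) : Path a.thread a b := by
  have key : ∀ c, Compat a c → c.thread = a.thread → c.parent a.thread = some p → a = c := by
    intro c hc htc hpc
    by_contra hne
    exact hc (.ti hne ⟨htc.symm, p, hp, by rw [htc]; exact hpc⟩)
  rcases Relation.ReflTransGen.cases_head hpq with rfl | ⟨c, hs, hc⟩
  · rw [← key b h ht.symm (by rw [ht]; exact hq)]
    exact Relation.ReflTransGen.refl
  · have hcb : Path a.thread c b := by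
      refine Relation.ReflTransGen.tail hc ⟨?_, ht.symm, by rw [ht]; exact hq⟩
      rw [(hb.parent hq).2, ht]
    have hac : Compat a c := by
      rcases hcb.eq_or_anc with rfl | h'
      · exact h
      · exact (ha.compat_anc h.symm h').symm
    rw [← key c hac hs.2.1 hs.2.2] at hcb
    exact hcb

/-- Compatible blocks of one thread are on a path. -/
theorem path_or_path {a b : Block T} (ha : Valid P a) (hb : Valid P b)
    (ht : a.thread = b.thread) (h : Compat a b) :
    Path a.thread a b ∨ Path a.thread b a := by
  by_cases hga : ∃ τ, a = .genesis τ
  · obtain ⟨τ, rfl⟩ := hga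
    left
    have := hb.genesis_path
    rw [← ht] at this
    exact this
  by_cases hgb : ∃ τ, b = .genesis τ
  · obtain ⟨τ, rfl⟩ := hgb
    right
    have := ha.genesis_path
    rw [ht] at this ⊢
    exact this
  push Not at hga hgb
  obtain ⟨p, hp⟩ := exists_parent hga a.thread
  obtain ⟨q, hq⟩ := exists_parent hgb b.thread
  by_cases h1 : Path a.thread p q
  · exact Or.inl (path_of_path_parent ha hb ht h hp hq h1)
  by_cases h2 : Path b.thread q p
  · right
    rw [ht]
    exact path_of_path_parent hb ha ht.symm h.symm hq hp h2
  · exfalso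
    have hab : a ≠ b := by
      rintro rfl
      rw [hp] at hq
      cases hq
      exact h1 Relation.ReflTransGen.refl
    exact h (.gpi hab ⟨p, q, q, p, hp, by rw [ht]; exact hq, hq, by rw [← ht]; exact hp, h1, h2⟩)

/-- This makes `slot` injective on compatible sets, so that their sizes can be compared with numbers
of slots. -/
theorem eq_of_compat_of_slot_eq {a b : Block T} (ha : Valid P a) (hb : Valid P b)
    (h : Compat a b) (hs : a.slot = b.slot) : a = b := by
  have ht := thread_eq_of_slot_eq hs
  have hn := num_eq_of_slot_eq hs
  rcases ha.path_or_path hb ht h with h | h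
  · exact hb.eq_of_path_of_num_eq h ht hn
  · exact (ha.eq_of_path_of_num_eq h ht.symm hn.symm).symm

end Valid
end Blockclique

namespace Blockclique
variable {T : ℕ} {P : Params T}
open Block
open Classical

/-! ### Cliques -/

theorem exists_isClique {S D : Finset (Block T)} (hD : D ⊆ S)
    (hc : ∀ a ∈ D, ∀ b ∈ D, Compat a b) : ∃ C, IsClique S C ∧ D ⊆ C := by
  have hfin : {D : Finset (Block T) | D ⊆ S ∧ ∀ a ∈ D, ∀ b ∈ D, Compat a b}.Finite :=
    S.powerset.finite_toSet.subset fun D h => by simpa using h.1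
  obtain ⟨C, hDC, hC⟩ := hfin.exists_le_maximal (a := D) ⟨hD, hc⟩
  exact ⟨C, hC, hDC⟩

theorem IsClique.subset {S C : Finset (Block T)} (h : IsClique S C) : C ⊆ S := h.prop.1

theorem IsClique.compat {S C : Finset (Block T)} (h : IsClique S C) {a b : Block T}
    (ha : a ∈ C) (hb : b ∈ C) : Compat a b := h.prop.2 a ha b hb

theorem IsClique.mem_of_compat {S C : Finset (Block T)} (h : IsClique S C) {a : Block T}
    (ha : a ∈ S) (hc : ∀ b ∈ C, Compat a b) : a ∈ C := by
  have : insert a C ≤ C := h.2 ⟨Finset.insert_subset ha h.subset, ?_⟩ (Finset.subset_insert a C)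
  · exact this (Finset.mem_insert_self a C)
  · intro x hx y hy
    rcases Finset.mem_insert.1 hx with h1 | h1 <;> rcases Finset.mem_insert.1 hy with h2 | h2
    · rw [h1, h2]; exact Compat.refl a
    · rw [h1]; exact hc y h2
    · rw [h2]; exact (hc x h1).symm
    · exact h.compat h1 h2

theorem exists_isClique_mem {S : Finset (Block T)} {a : Block T} (ha : a ∈ S) :
    ∃ C, IsClique S C ∧ a ∈ C := by
  obtain ⟨C, hC, h⟩ := exists_isClique (S := S) (D := {a}) (by simpa using ha)
    (by simp [Compat.refl])
  exact ⟨C, hC, h (by simp)⟩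

theorem exists_isBest {S C : Finset (Block T)} (hC : IsClique S C) :
    ∃ B, IsBest S B ∧ fit C ≤ fit B := by
  have hfin : {D : Finset (Block T) | IsClique S D}.Finite :=
    S.powerset.finite_toSet.subset fun D h => by simpa using h.subset
  obtain ⟨B, hB, hm⟩ := hfin.exists_maximalFor fit _ ⟨C, hC⟩
  have : ∀ D, IsClique S D → fit D ≤ fit B := fun D hD => by
    rcases le_total (fit D) (fit B) with h | h
    · exact h
    · exact hm hD h
  exact ⟨B, ⟨hB, this⟩, this C hC⟩

/-- Being compatible with everything, a genesis block lies in every clique, in particular in a best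
one. -/
theorem not_staleIn_genesis {S : Finset (Block T)} {τ : Fin T} (h : genesis τ ∈ S) :
    ¬ StaleIn P S (genesis τ) := by
  intro hs
  obtain ⟨C, hC, hmem⟩ := exists_isClique_mem h
  obtain ⟨B, hB, -⟩ := exists_isBest hC
  obtain ⟨B', hB', hlt⟩ := hs B hB.1 (hB.1.mem_of_compat h fun b _ => genesis_compat τ b)
  have := hB.2 B' hB'.1
  omega

theorem fit_eq_card (hE : P.E = 0) {C : Finset (Block T)} (h : ∀ b ∈ C, Valid P b) :
    fit C = C.card := by
  unfold fit
  rw [Finset.card_eq_sum_ones]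
  exact Finset.sum_congr rfl fun b hb => (h b hb).fitness_eq hE

/-! ### States of nodes -/

/-- The blocks known to a node that has processed the blocks of `l`. -/
def Known (l : List (Block T)) (b : Block T) : Prop := (∃ τ, b = .genesis τ) ∨ b ∈ l

theorem nodeState_concat (P : Params T) (l : List (Block T)) (x : Block T) :
    nodeState P (l ++ [x]) = (nodeState P l).step P x := by
  simp [nodeState, List.foldl_append]

/-- A new block that is not stale when it is processed. -/
def Accepted (s : NodeState T) (x : Block T) : Prop :=
  ¬ ((∃ τ p, x.parent τ = some p ∧ p ∈ s.stale) ∨ ∃ f ∈ s.final, Block.Incompat f x)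

theorem step_of_not_accepted {s : NodeState T} {x : Block T} (h : ¬ Accepted s x) :
    s.step P x = { s with stale := insert x s.stale } := by
  unfold Accepted at h
  rw [not_not] at h
  simp only [NodeState.step, if_pos h]

theorem step_of_accepted {s : NodeState T} {x : Block T} (h : Accepted s x) :
    s.step P x =
      { final := s.final ∪ {y ∈ {y ∈ insert x s.head | ¬ StaleIn P (insert x s.head) y} |
          FinalIn P {y ∈ insert x s.head | ¬ StaleIn P (insert x s.head) y} y}
        stale := s.stale ∪ {y ∈ insert x s.head | StaleIn P (insert x s.head) y}
        head := {y ∈ {y ∈ insert x s.head | ¬ StaleIn P (insert x s.head) y} |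
          ¬ FinalIn P {y ∈ insert x s.head | ¬ StaleIn P (insert x s.head) y} y} } := by
  unfold Accepted at h
  simp only [NodeState.step, if_neg h]

theorem stale_subset_step (s : NodeState T) (x : Block T) : s.stale ⊆ (s.step P x).stale := by
  by_cases h : Accepted s x
  · rw [step_of_accepted h]
    exact Finset.subset_union_left
  · rw [step_of_not_accepted h]
    exact Finset.subset_insert _ _

theorem stale_subset_of_prefix {l l' : List (Block T)} (h : l <+: l') :
    (nodeState P l).stale ⊆ (nodeState P l').stale := by
  obtain ⟨r, rfl⟩ := h
  induction r using List.reverseRecOn with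
  | nil => simp
  | append_singleton r x ih =>
    rw [← List.append_assoc, nodeState_concat]
    exact ih.trans (stale_subset_step _ _)

/-- Facts about the state of a node that hold whatever blocks it processes. -/
structure NodeState.Sound (P : Params T) (s : NodeState T) (l : List (Block T)) : Prop where
  known : ∀ b, b ∈ s.final ∨ b ∈ s.stale ∨ b ∈ s.head ↔ Known l b
  compat : ∀ f ∈ s.final, ∀ b, b ∈ s.final ∨ b ∈ s.head → Compat f b
  genesis : ∀ τ, Block.genesis τ ∉ s.stale
  descendants : ∀ f ∈ s.final, ∃ C : Finset (Block T), (∀ b ∈ C, Known l b) ∧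
    (∀ a ∈ C, ∀ b ∈ C, Compat a b) ∧ P.threshold < fit {d ∈ C | Anc f d}

theorem Known.mono {l l' : List (Block T)} (h : l ⊆ l') {b : Block T} (hb : Known l b) :
    Known l' b := hb.imp_right fun hb => h hb

theorem known_concat {l : List (Block T)} {x b : Block T} :
    Known (l ++ [x]) b ↔ b = x ∨ Known l b := by
  unfold Known
  simp only [List.mem_append, List.mem_singleton]
  tauto

/-- A newly final block lies in all cliques, and every remaining block lies in some clique, whence
compatibility. The clique that witnesses finality is kept as a set of known blocks, since its
members may be settled later. -/
theorem NodeState.Sound.step {s : NodeState T} {l : List (Block T)} (h : s.Sound P l) (x : Block T)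
    (hx : ∀ τ, x ≠ .genesis τ) : (s.step P x).Sound P (l ++ [x]) := by
  have hmono : l ⊆ l ++ [x] := List.subset_append_left _ _
  by_cases ha : Accepted s x
  · rw [step_of_accepted ha]
    unfold Accepted at ha
    push Not at ha
    have hH1 : ∀ b ∈ insert x s.head, Known (l ++ [x]) b := by
      intro b hb
      rw [known_concat]
      exact (Finset.mem_insert.1 hb).imp_right fun hb => (h.known b).1 (Or.inr (Or.inr hb))
    have hfH1 : ∀ f ∈ s.final, ∀ b ∈ insert x s.head, Compat f b := by
      intro f hf b hb
      rcases Finset.mem_insert.1 hb with rfl | hb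
      · exact ha.2 f hf
      · exact h.compat f hf b (Or.inr hb)
    set H₁ := insert x s.head with hH1def
    set H₂ := {y ∈ H₁ | ¬ StaleIn P H₁ y} with hH2def
    have hsub : H₂ ⊆ H₁ := Finset.filter_subset _ _
    refine ⟨?_, ?_, ?_, ?_⟩
    · intro b
      rw [known_concat, ← h.known b]
      have : b ∈ H₁ ↔ b = x ∨ b ∈ s.head := Finset.mem_insert
      simp only [Finset.mem_union, Finset.mem_filter, hH2def]
      tauto
    · have hnew : ∀ f ∈ H₂, FinalIn P H₂ f → ∀ b ∈ H₂, Compat f b := by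
        intro f _ hfin b hb
        obtain ⟨C, hC, hbC⟩ := exists_isClique_mem hb
        exact hC.compat (hfin.1 C hC) hbC
      intro f hf b hb
      simp only [Finset.mem_union, Finset.mem_filter] at hf hb
      have hb' : b ∈ s.final ∨ b ∈ H₂ := by tauto
      rcases hf with hf | hf <;> rcases hb' with hb | hb
      · exact h.compat f hf b (Or.inl hb)
      · exact hfH1 f hf b (hsub hb)
      · exact (hfH1 b hb f (hsub hf.1)).symm
      · exact hnew f hf.1 hf.2 b hb
    · intro τ hτ
      simp only [Finset.mem_union, Finset.mem_filter] at hτ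
      rcases hτ with hτ | ⟨h1, h2⟩
      · exact h.genesis τ hτ
      · exact not_staleIn_genesis h1 h2
    · intro f hf
      simp only [Finset.mem_union, Finset.mem_filter] at hf
      rcases hf with hf | ⟨-, -, C, hC, -, hlt⟩
      · obtain ⟨C, h1, h2, h3⟩ := h.descendants f hf
        exact ⟨C, fun b hb => (h1 b hb).mono hmono, h2, h3⟩
      · exact ⟨C, fun b hb => hH1 b (hsub (hC.subset hb)), fun a ha b hb => hC.compat ha hb, hlt⟩
  · rw [step_of_not_accepted ha]
    refine ⟨?_, h.compat, ?_, ?_⟩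
    · intro b
      rw [known_concat, ← h.known b]
      simp only [Finset.mem_insert]
      tauto
    · intro τ hτ
      rcases Finset.mem_insert.1 hτ with hτ | hτ
      · exact hx τ hτ.symm
      · exact h.genesis τ hτ
    · intro f hf
      obtain ⟨C, h1, h2, h3⟩ := h.descendants f hf
      exact ⟨C, fun b hb => (h1 b hb).mono hmono, h2, h3⟩

theorem sound_nodeState {l : List (Block T)} (h : ∀ b ∈ l, ∀ τ, b ≠ .genesis τ) :
    (nodeState P l).Sound P l := by
  induction l using List.reverseRecOn with
  | nil =>
    refine ⟨?_, ?_, ?_, ?_⟩ <;> simp [nodeState, NodeState.init, Known, eq_comm]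
  | append_singleton l x ih =>
    rw [nodeState_concat]
    exact (ih fun b hb => h b (List.mem_append_left _ hb)).step x (h x (by simp))

end Blockclique

namespace Blockclique
variable {T : ℕ} {P : Params T}
open Block
open Classical

/-! ### Slots of the threads -/

/-- The slots up to `m`, from the block slot number `v τ` on in thread `τ`. -/
noncomputable def slotsFrom (m : ℕ) (v : Fin T → ℕ) : Finset ℕ :=
  {k ∈ Finset.range (m + 1) | ∃ τ : Fin T, k % T = τ ∧ v τ ≤ k / T}

theorem Block.slot_div (b : Block T) : b.slot / T = b.num := by
  have hT : 0 < T := b.thread.pos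
  unfold slot
  rw [Nat.mul_comm, Nat.mul_add_div hT, Nat.div_eq_of_lt b.thread.2, Nat.add_zero]

theorem Block.num_le_slot (b : Block T) : b.num ≤ b.slot :=
  b.slot_div ▸ Nat.div_le_self _ _

theorem slot_mem_slotsFrom {m : ℕ} {v : Fin T → ℕ} {b : Block T} :
    b.slot ∈ slotsFrom m v ↔ b.slot ≤ m ∧ v b.thread ≤ b.num := by
  unfold slotsFrom
  rw [Finset.mem_filter, Finset.mem_range, Nat.lt_succ_iff, b.slot_mod, b.slot_div]
  refine and_congr_right fun _ => ⟨?_, fun h => ⟨_, rfl, h⟩⟩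
  rintro ⟨τ, h1, h2⟩
  rwa [Fin.ext h1]

/-- Some final segments of the threads, of total length about `F / c`, have almost as many slots in
`Z` as slots in `S`. -/
def Bad (T m F c : ℕ) (S Z : Set ℕ) : Prop :=
  ∃ v : Fin T → ℕ, (∀ τ, 1 ≤ v τ) ∧
    ({k ∈ slotsFrom m v | k ∈ S}).card ≤ ({k ∈ slotsFrom m v | k ∈ Z}).card + c ∧
    F ≤ c * ((slotsFrom m v).card + 1)

/-! ### The blocks of honest nodes -/

/-- `H` consists of the genesis blocks and the blocks of honest nodes, which are created in the
slots of `S`, up to slot `m`. -/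
structure HonestChain (P : Params T) (m : ℕ) (S : Set ℕ) (H : Set (Block T)) : Prop where
  genesis_mem : ∀ τ, Block.genesis τ ∈ H
  valid : ∀ b ∈ H, Valid P b
  parent_mem : ∀ b ∈ H, ∀ σ p, b.parent σ = some p → p ∈ H ∧ p.slot < b.slot
  eq_of_slot_eq : ∀ a ∈ H, ∀ b ∈ H, a.slot = b.slot → a = b
  slot_mem : ∀ b ∈ H, (∀ τ, b ≠ .genesis τ) → b.slot ∈ S
  exists_block : ∀ k ∈ S, ∃ b ∈ H, b.slot = k
  bounds : ∀ k ∈ S, T ≤ k ∧ k ≤ m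
  tip : ∀ a ∈ H, ∀ b ∈ H, a.slot + T ≤ b.slot → ∀ p, b.parent a.thread = some p →
    a.slot ≤ p.slot

namespace HonestChain

variable {m : ℕ} {S Z : Set ℕ} {H : Set (Block T)}

theorem add_le_of_slot_lt {a b : Block T} (ht : a.thread = b.thread) (h : a.slot < b.slot) :
    a.slot + T ≤ b.slot := by
  have := (slot_lt_iff_num ht).1 h
  unfold slot
  rw [ht]
  nlinarith

theorem genesis_slot_lt (τ : Fin T) : (Block.genesis τ).slot < T := by
  simp [slot, num, thread]

/-- By `tip`, the thread parent of a later honest block is not before `a`, so descending along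
parents ends in `a`. -/
theorem path (hH : HonestChain P m S H) {a b : Block T} (ha : a ∈ H) (hb : b ∈ H)
    (ht : a.thread = b.thread) (h : a.slot ≤ b.slot) : Path a.thread a b := by
  obtain ⟨n, hn⟩ : ∃ n, b.slot = n := ⟨_, rfl⟩
  induction n using Nat.strong_induction_on generalizing b with
  | _ n ih =>
  rcases h.eq_or_lt with h | h
  · rw [← hH.eq_of_slot_eq a ha b hb h]
    exact Relation.ReflTransGen.refl
  · have hg : ∀ τ, b ≠ .genesis τ := by
      rintro τ rfl
      have := add_le_of_slot_lt ht h
      have := genesis_slot_lt τ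
      omega
    obtain ⟨p, hp⟩ := Valid.exists_parent hg a.thread
    have hp' := hH.parent_mem b hb _ p hp
    have htp := ((hH.valid b hb).parent hp).2
    exact Relation.ReflTransGen.tail (ih p.slot (hn ▸ hp'.2) hp'.1 htp.symm
      (hH.tip a ha b hb (add_le_of_slot_lt ht h) p hp) rfl) ⟨htp, ht.symm, hp⟩

theorem not_ti (hH : HonestChain P m S H) {a b : Block T} (ha : a ∈ H) (hb : b ∈ H)
    (h : TI a b) : ¬ a.slot < b.slot := by
  intro hlt
  obtain ⟨ht, p, hp, hq⟩ := h
  have h1 := hH.tip a ha b hb (add_le_of_slot_lt ht hlt) p (by rw [ht]; exact hq)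
  exact absurd (hH.parent_mem a ha _ p hp).2 (not_lt.2 h1)

theorem not_gpi (hH : HonestChain P m S H) {a b : Block T} (ha : a ∈ H) (hb : b ∈ H)
    (h : GPI a b) : ¬ a.slot ≤ b.slot := by
  intro hle
  obtain ⟨p, q, _, _, hp, hq, _, _, h, _⟩ := h
  have hpm := hH.parent_mem a ha _ p hp
  have hqm := hH.parent_mem b hb _ q hq
  have htp := ((hH.valid a ha).parent hp).2
  have htq := ((hH.valid b hb).parent hq).2
  apply h
  -- The parent `p` lies at least one period before `a`, hence before `b`, so `tip` applies to `p`
  -- and `b` even when `a` is too recent for it.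
  have := add_le_of_slot_lt htp hpm.2
  have h2 := hH.tip p hpm.1 b hb (by omega) q (by rw [htp]; exact hq)
  have h3 := hH.path hpm.1 hqm.1 (htp.trans htq.symm) h2
  rwa [htp] at h3

theorem compat (hH : HonestChain P m S H) {a b : Block T} (ha : a ∈ H) (hb : b ∈ H) :
    Compat a b := by
  intro h
  induction h with
  | @ti a b hne h =>
    rcases lt_trichotomy a.slot b.slot with h1 | h1 | h1
    · exact hH.not_ti ha hb h h1
    · exact hne (hH.eq_of_slot_eq a ha b hb h1)
    · exact hH.not_ti hb ha h.symm h1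
  | @gpi a b hne h =>
    rcases le_total a.slot b.slot with h1 | h1
    · exact hH.not_gpi ha hb h h1
    · exact hH.not_gpi hb ha h.symm h1
  | left τ hne hp _ ih => exact ih (hH.parent_mem _ ha _ _ hp).1 hb
  | right τ hne hp _ ih => exact ih ha (hH.parent_mem _ hb _ _ hp).1

theorem mem_of_anc (hH : HonestChain P m S H) {a b : Block T} (hb : b ∈ H) (h : Anc a b) :
    a ∈ H := by
  induction h using Relation.TransGen.head_induction_on with
  | single h => exact (hH.parent_mem _ hb _ _ h.choose_spec).1
  | head h _ ih => exact (hH.parent_mem _ ih _ _ h.choose_spec).1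

/-- Blocks that are not on the honest chain are incompatible with the later honest blocks of their
thread. -/
theorem not_compat (hH : HonestChain P m S H) {f b : Block T} (hf : Valid P f) (hfH : f ∉ H)
    (hb : b ∈ H) (ht : f.thread = b.thread) (hn : f.num ≤ b.num) : ¬ Compat f b := by
  intro hc
  rcases hf.path_or_path (hH.valid b hb) ht hc with h | h
  · rcases h.eq_or_anc with rfl | h
    · exact hfH hb
    · exact hfH (hH.mem_of_anc hb h)
  · have := hf.num_le_of_path h
    rw [hf.eq_of_path_of_num_eq h ht.symm (le_antisymm this hn)] at hb
    exact hfH hb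

theorem anc_of_add_le (hH : HonestChain P m S H) {a b : Block T} (ha : a ∈ H) (hb : b ∈ H)
    (h : a.slot + T ≤ b.slot) : Anc a b := by
  have hg : ∀ τ, b ≠ .genesis τ := by
    rintro τ rfl
    have := genesis_slot_lt τ
    omega
  obtain ⟨p, hp⟩ := Valid.exists_parent hg a.thread
  have htp := ((hH.valid b hb).parent hp).2
  have h1 := hH.path ha (hH.parent_mem b hb _ p hp).1 htp.symm (hH.tip a ha b hb h p hp)
  rcases h1.eq_or_anc with h1 | h1
  · rw [h1]; exact anc_of_parent hp
  · exact h1.trans (anc_of_parent hp)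

theorem card_late_le (m : ℕ) (s : Finset ℕ) (h : ∀ k ∈ s, m < k + T ∧ k ≤ m) : s.card ≤ T := by
  have : s ⊆ Finset.Ico (m + 1 - T) (m + 1) := fun k hk => by
    have := h k hk
    rw [Finset.mem_Ico]
    omega
  have := Finset.card_le_card this
  rw [Nat.card_Ico] at this
  omega

/-- From the first block of a compatible set `B` outside the honest chain on, the honest blocks of
each thread are not in `B`. -/
theorem exists_slotsFrom (hH : HonestChain P m S H) {B G : Finset (Block T)}
    (hB : ∀ b ∈ B, b ∉ H → Valid P b ∧ b.slot ≤ m ∧ b.slot ∈ Z)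
    (hBc : ∀ a ∈ B, ∀ b ∈ B, Compat a b)
    (hG : ∀ b ∈ H, b.slot + T ≤ m → b ∈ G ∨ ∀ x ∈ B, Compat x b) :
    ∃ v : Fin T → ℕ, (∀ τ, 1 ≤ v τ) ∧
      ({b ∈ B | b ∉ H}).card ≤ ({k ∈ slotsFrom m v | k ∈ Z}).card ∧
      ({k ∈ slotsFrom m v | k ∈ S}).card ≤ ({b ∈ G | b ∈ H ∧ b ∉ B}).card + T := by
  let Q : Fin T → ℕ → Prop := fun τ n => ∃ b ∈ B, b ∉ H ∧ b.thread = τ ∧ b.num = n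
  -- A thread without foreign blocks gets an empty segment: `m + 1` exceeds the number of every slot
  -- up to `m`.
  let v : Fin T → ℕ := fun τ => if h : ∃ n, Q τ n then Nat.find h else m + 1
  have hv1 : ∀ b ∈ B, b ∉ H → v b.thread ≤ b.num := by
    intro b hb hbH
    have h : ∃ n, Q b.thread n := ⟨_, b, hb, hbH, rfl, rfl⟩
    simp only [v, dif_pos h]
    exact Nat.find_min' h ⟨b, hb, hbH, rfl, rfl⟩
  have hv2 : ∀ τ, v τ ≤ m → ∃ b ∈ B, b ∉ H ∧ b.thread = τ ∧ b.num = v τ := by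
    intro τ hτ
    by_cases h : ∃ n, Q τ n
    · have := Nat.find_spec h
      simp only [v, dif_pos h]
      exact this
    · simp only [v, dif_neg h] at hτ
      omega
  refine ⟨v, ?_, ?_, ?_⟩
  · intro τ
    by_contra h0
    obtain ⟨b, hb, hbH, -, hn⟩ := hv2 τ (by omega)
    have := (hB b hb hbH).1.num_pos (by rintro σ rfl; exact hbH (hH.genesis_mem σ))
    omega
  · apply Finset.card_le_card_of_injOn slot
    · intro b hb
      simp only [Finset.coe_filter, Set.mem_ofPred_eq] at hb ⊢
      have := hB b hb.1 hb.2
      exact ⟨slot_mem_slotsFrom.2 ⟨this.2.1, hv1 b hb.1 hb.2⟩, this.2.2⟩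
    · intro a ha b hb hab
      simp only [Finset.coe_filter, Set.mem_ofPred_eq] at ha hb
      exact (hB a ha.1 ha.2).1.eq_of_compat_of_slot_eq (hB b hb.1 hb.2).1
        (hBc a ha.1 b hb.1) hab
  · have hsplit : {k ∈ slotsFrom m v | k ∈ S} ⊆
        ({b ∈ G | b ∈ H ∧ b ∉ B}).image slot ∪
          {k ∈ slotsFrom m v | k ∈ S ∧ m < k + T} := by
      intro k hk
      rw [Finset.mem_filter] at hk
      obtain ⟨hkA, hkS⟩ := hk
      rw [Finset.mem_union, Finset.mem_image]
      -- Blocks of the last `T` slots may be undelivered; they account for the summand `T`.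
      by_cases hkm : m < k + T
      · exact Or.inr (Finset.mem_filter.2 ⟨hkA, hkS, hkm⟩)
      · left
        obtain ⟨b, hb, rfl⟩ := hH.exists_block k hkS
        have hb1 := slot_mem_slotsFrom.1 hkA
        obtain ⟨b₀, hb₀, hb₀H, ht, hn⟩ := hv2 b.thread
          (hb1.2.trans (b.num_le_slot.trans hb1.1))
        have hnc : ¬ Compat b₀ b := hH.not_compat (hB b₀ hb₀ hb₀H).1 hb₀H hb ht (hn ▸ hb1.2)
        refine ⟨b, Finset.mem_filter.2 ⟨?_, hb, fun hbB => hnc (hBc b₀ hb₀ b hbB)⟩, rfl⟩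
        exact (hG b hb (not_lt.1 hkm)).resolve_right fun h => hnc (h b₀ hb₀)
    refine (Finset.card_le_card hsplit).trans ((Finset.card_union_le _ _).trans
      (Nat.add_le_add Finset.card_image_le (card_late_le m _ fun k hk => ?_)))
    have hk := (Finset.mem_filter.1 hk).2
    exact ⟨hk.2, (hH.bounds k hk.1).2⟩

end HonestChain

/-- The list `l` of blocks processed by an honest node that has not discarded any honest block. -/
structure HonestLog (P : Params T) (m : ℕ) (Z : Set ℕ) (H : Set (Block T))
    (l : List (Block T)) : Prop where
  valid : ∀ b ∈ l, Valid P b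
  ne_genesis : ∀ b ∈ l, ∀ τ, b ≠ .genesis τ
  slot_le : ∀ b ∈ l, b.slot ≤ m
  selected : ∀ b ∈ l, b ∈ H ∨ b.slot ∈ Z
  delivered : ∀ b ∈ H, b.slot + T ≤ m → Known l b
  not_stale : ∀ b ∈ H, b ∉ (nodeState P l).stale

/-! ### Failures of the consensus force bad segments. -/

namespace HonestLog

variable {m : ℕ} {S Z : Set ℕ} {H : Set (Block T)} {l l' : List (Block T)}

theorem sound (hl : HonestLog P m Z H l) : (nodeState P l).Sound P l :=
  sound_nodeState hl.ne_genesis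

theorem valid_of_known (hl : HonestLog P m Z H l) {b : Block T} (hb : Known l b) : Valid P b := by
  rcases hb with ⟨τ, rfl⟩ | hb
  exacts [Valid.genesis τ, hl.valid b hb]

theorem known_of_final (hl : HonestLog P m Z H l) {b : Block T}
    (hb : b ∈ (nodeState P l).final) : Known l b := (hl.sound.known b).1 (Or.inl hb)

theorem known_of_head (hl : HonestLog P m Z H l) {b : Block T}
    (hb : b ∈ (nodeState P l).head) : Known l b := (hl.sound.known b).1 (Or.inr (Or.inr hb))

theorem mem_final_or_head (hl : HonestLog P m Z H l) {b : Block T} (hb : b ∈ H)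
    (hk : Known l b) : b ∈ (nodeState P l).final ∨ b ∈ (nodeState P l).head := by
  have h1 := (hl.sound.known b).2 hk
  have h2 := hl.not_stale b hb
  tauto

theorem mem_of_anc {a b : Block T} (h : Anc a b) (hb : Known l b) :
    b ∈ l :=
  hb.resolve_left fun ⟨τ, h'⟩ => Valid.ne_genesis_of_anc h τ h'

/-- A lower bound for the number of slots in which a final block has descendants. -/
theorem threshold_lt_card (hl : HonestLog P m Z H l) (hE : P.E = 0) {f : Block T}
    (hf : f ∈ (nodeState P l).final) {A : Finset ℕ}
    (hA : ∀ d ∈ l, Anc f d → d.slot ∈ A) : P.threshold < A.card := by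
  obtain ⟨C, h1, h2, h3⟩ := hl.sound.descendants f hf
  have hv : ∀ b ∈ C, Valid P b := fun b hb => hl.valid_of_known (h1 b hb)
  rw [fit_eq_card hE fun b hb => hv b (Finset.mem_filter.1 hb).1] at h3
  refine lt_of_lt_of_le h3 (Finset.card_le_card_of_injOn slot ?_ ?_)
  · intro d hd
    simp only [Finset.coe_filter, Set.mem_ofPred_eq] at hd
    exact hA d (mem_of_anc hd.2 (h1 d hd.1)) hd.2
  · intro a ha b hb hab
    simp only [Finset.coe_filter, Set.mem_ofPred_eq] at ha hb
    exact (hv a ha.1).eq_of_compat_of_slot_eq (hv b hb.1) (h2 a ha.1 b hb.1) hab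

theorem exists_last_honest (l : List (Block T)) (hH : HonestChain P m S H) (τ : Fin T) :
    ∃ q ∈ H, Known l q ∧ q.thread = τ ∧
      ∀ b ∈ H, Known l b → b.thread = τ → b.num ≤ q.num := by
  obtain ⟨q, hq, hmax⟩ := Finset.exists_max_image
    {b ∈ insert (.genesis τ) l.toFinset | b ∈ H ∧ b.thread = τ} num
    ⟨.genesis τ, Finset.mem_filter.2 ⟨Finset.mem_insert_self _ _, hH.genesis_mem τ, rfl⟩⟩
  simp only [Finset.mem_filter, Finset.mem_insert, List.mem_toFinset] at hq hmax
  refine ⟨q, hq.2.1, hq.1.imp (fun h => ⟨τ, h⟩) id, hq.2.2, ?_⟩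
  intro b hb hk ht
  refine hmax b ⟨?_, hb, ht⟩
  rcases hk with ⟨σ, rfl⟩ | hk
  · left; rw [← ht]; rfl
  · exact Or.inr hk

/-- In each thread a block separates the late honest blocks and the descendants of the honest
block `q` from the honest blocks that `q` builds on. -/
theorem exists_separating (hH : HonestChain P m S H) {q : Block T} (hq : q ∈ H) (σ : Fin T) :
    ∃ n, (∀ d, Valid P d → Anc q d → d.thread = σ → n < d.num) ∧
      ∀ b ∈ H, b.slot ∈ S → b.thread = σ → n < b.num → q.slot < b.slot + T := by
  by_cases hg : ∃ τ, q = .genesis τ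
  · obtain ⟨τ, rfl⟩ := hg
    refine ⟨0, fun d hd h _ => hd.num_pos (Valid.ne_genesis_of_anc h), fun b _ hb _ _ => ?_⟩
    have := HonestChain.genesis_slot_lt τ
    omega
  · push Not at hg
    obtain ⟨p, hp⟩ := Valid.exists_parent hg σ
    have htp := ((hH.valid q hq).parent hp).2
    refine ⟨p.num, fun d hd h ht => ?_, fun b hb _ ht hn => ?_⟩
    · exact hd.num_lt_of_anc ((anc_of_parent hp).trans h) (htp.trans ht.symm)
    · by_contra hlt
      have h1 := hH.tip b hb q hq (not_lt.1 hlt) p (by rw [ht]; exact hp)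
      have h2 := (slot_le_iff_num (ht.trans htp.symm)).1 h1
      omega

theorem le_card_slotsFrom {v : Fin T → ℕ} (q : Block T) (hv : v q.thread ≤ q.num + 1) :
    (m - q.slot) / T ≤ (slotsFrom m v).card := by
  have hT : 0 < T := q.thread.pos
  have hinj : Function.Injective fun j => q.slot + (j + 1) * T := by
    intro i j hij
    have : (i + 1) * T = (j + 1) * T := by simpa using hij
    have := Nat.eq_of_mul_eq_mul_right hT this
    omega
  calc (m - q.slot) / T = ((Finset.range ((m - q.slot) / T)).image
        fun j => q.slot + (j + 1) * T).card := by
        rw [Finset.card_image_of_injective _ hinj, Finset.card_range]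
    _ ≤ _ := by
        apply Finset.card_le_card
        intro k hk
        obtain ⟨j, hj, rfl⟩ := Finset.mem_image.1 hk
        have hj := Finset.mem_range.1 hj
        have h1 : (j + 1) * T ≤ m - q.slot :=
          (Nat.mul_le_mul_right T hj).trans (Nat.div_mul_le_self _ _)
        have h2 : T ≤ (j + 1) * T := Nat.le_mul_of_pos_left T (Nat.succ_pos j)
        unfold slotsFrom
        rw [Finset.mem_filter, Finset.mem_range]
        refine ⟨by omega, q.thread, ?_, ?_⟩
        · rw [Nat.add_mul_mod_self_right, q.slot_mod]
        · rw [Nat.add_mul_div_right _ _ hT, q.slot_div]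
          omega

/-- If a block outside the honest chain becomes final, the attacker was lucky. -/
theorem bad_of_final_notMem (hl : HonestLog P m Z H l) (hH : HonestChain P m S H)
    (hE : P.E = 0) {f : Block T} (hf : f ∈ (nodeState P l).final) (hfH : f ∉ H) :
    Bad T m P.threshold (6 * T) S Z := by
  have hT : 0 < T := f.thread.pos
  have hfv := hl.valid_of_known (hl.known_of_final hf)
  have hfc : ∀ b ∈ H, Known l b → Compat f b := fun b hb hk =>
    hl.sound.compat f hf b (hl.mem_final_or_head hb hk)
  obtain ⟨q, hq, hqk, hqt, hmax⟩ := exists_last_honest l hH f.thread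
  have hqf : q.num < f.num := by
    by_contra h
    exact hH.not_compat hfv hfH hq hqt.symm (not_lt.1 h) (hfc q hq hqk)
  have hqa : Anc q f := by
    rcases hfv.path_or_path (hH.valid q hq) hqt.symm (hfc q hq hqk) with h | h
    · exact absurd ((hH.valid q hq).num_le_of_path h) (not_le.2 hqf)
    · exact h.eq_or_anc.resolve_left (by rintro rfl; exact hfH hq)
  choose y hy1 hy2 using fun σ => exists_separating (P := P) hH hq σ
  -- Recent `q`: `f` has more than F descendants, all in Byzantine slots beyond the separating
  -- blocks, where at most `m + T - q.slot` slots are honest.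
  by_cases hF : m + T - q.slot ≤ P.threshold
  · let v : Fin T → ℕ := fun σ => y σ + 1
    have hbyz : P.threshold < ({k ∈ slotsFrom m v | k ∈ Z}).card := by
      refine hl.threshold_lt_card hE hf fun d hd hfd => ?_
      rw [Finset.mem_filter, slot_mem_slotsFrom]
      refine ⟨⟨hl.slot_le d hd, hy1 _ d (hl.valid d hd) (hqa.trans hfd) rfl⟩, ?_⟩
      exact (hl.selected d hd).resolve_left fun h => hfH (hH.mem_of_anc h hfd)
    have hhon : ({k ∈ slotsFrom m v | k ∈ S}).card ≤ m + T - q.slot := by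
      have : {k ∈ slotsFrom m v | k ∈ S} ⊆ Finset.Ico (q.slot + 1 - T) (m + 1) := by
        intro k hk
        rw [Finset.mem_filter] at hk
        obtain ⟨b, hb, rfl⟩ := hH.exists_block k hk.2
        have h1 := slot_mem_slotsFrom.1 hk.1
        have h2 := hy2 _ b hb hk.2 rfl h1.2
        rw [Finset.mem_Ico]
        omega
      have := Finset.card_le_card this
      rw [Nat.card_Ico] at this
      omega
    refine ⟨v, fun σ => Nat.le_add_left 1 _, by omega, ?_⟩
    have := Finset.card_filter_le (slotsFrom m v) (· ∈ Z)
    nlinarith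
  -- Old `q`: the thread of `f` alone, from just after `q`, is long enough. Its honest blocks there
  -- are unknown to the node, hence in the last `T` slots; `m + 1` empties the other threads.
  · let v : Fin T → ℕ := fun σ => if σ = f.thread then q.num + 1 else m + 1
    refine ⟨v, fun σ => by simp only [v]; split_ifs <;> omega, ?_, ?_⟩
    · have : ({k ∈ slotsFrom m v | k ∈ S}).card ≤ T := by
        refine HonestChain.card_late_le m _ fun k hk => ?_
        rw [Finset.mem_filter] at hk
        obtain ⟨b, hb, rfl⟩ := hH.exists_block k hk.2
        have h1 := slot_mem_slotsFrom.1 hk.1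
        refine ⟨?_, h1.1⟩
        by_contra hlt
        have hk := hl.delivered b hb (not_lt.1 hlt)
        by_cases ht : b.thread = f.thread
        · have h2 := h1.2
          simp only [v, if_pos ht] at h2
          have := hmax b hb hk ht
          omega
        · have h2 := h1.2
          simp only [v, if_neg ht] at h2
          have := b.num_le_slot
          omega
      omega
    · have h1 : (m - q.slot) / T ≤ (slotsFrom m v).card :=
        le_card_slotsFrom q (by simp only [v, if_pos hqt]; exact le_rfl)
      have h2 := Nat.lt_mul_div_succ (m - q.slot) hT
      have h3 : T * ((m - q.slot) / T + 1) ≤ T * ((slotsFrom m v).card + 1) :=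
        Nat.mul_le_mul_left T (by omega)
      have h4 : T ≤ T * ((slotsFrom m v).card + 1) := Nat.le_mul_of_pos_right T (Nat.succ_pos _)
      have h5 : 6 * T * ((slotsFrom m v).card + 1) = 6 * (T * ((slotsFrom m v).card + 1)) := by ring
      omega

/-- The honest blocks of `B` count on both sides and cancel. -/
theorem card_add_le {G B : Finset (Block T)} (hBG : B ⊆ G) {F : ℕ}
    (h : ({b ∈ G | b ∈ H}).card + F ≤ B.card) :
    ({b ∈ G | b ∈ H ∧ b ∉ B}).card + F ≤ ({b ∈ B | b ∉ H}).card := by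
  have h1 := Finset.card_filter_add_card_filter_not (s := B) (· ∈ H)
  have h2 := Finset.card_filter_add_card_filter_not (s := {b ∈ G | b ∈ H}) (· ∈ B)
  rw [Finset.filter_filter, Finset.filter_filter] at h2
  have h3 : {b ∈ G | b ∈ H ∧ b ∈ B} = {b ∈ B | b ∈ H} := by
    ext b
    simp only [Finset.mem_filter]
    exact ⟨fun h => ⟨h.2.2, h.2.1⟩, fun h => ⟨hBG h.1, h.2, h.1⟩⟩
  rw [h3] at h2
  omega

/-- If an honest block is discarded, the attacker was lucky. -/
theorem bad_of_mem_stale_step (hl : HonestLog P m Z H l) (hH : HonestChain P m S H)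
    (hE : P.E = 0) {x b : Block T} (hxv : Valid P x) (hxm : x.slot ≤ m)
    (hxs : x ∈ H ∨ x.slot ∈ Z) (hb : b ∈ H) (hbs : b ∈ ((nodeState P l).step P x).stale) :
    Bad T m P.threshold (6 * T) S Z := by
  have hT : 0 < T := b.thread.pos
  have hb0 := hl.not_stale b hb
  by_cases ha : Accepted (nodeState P l) x
  · rw [step_of_accepted ha] at hbs
    unfold Accepted at ha
    push Not at ha
    simp only [Finset.mem_union, Finset.mem_filter, hb0, false_or] at hbs
    set G := insert x (nodeState P l).head
    -- The unsettled honest blocks extend to a clique containing `b`; as `b` is stale, a best clique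
    -- exceeds it by more than the threshold.
    obtain ⟨C, hC, hHC⟩ := exists_isClique (S := G) (D := {b ∈ G | b ∈ H})
      (Finset.filter_subset _ _) fun a ha b hb =>
        hH.compat (Finset.mem_filter.1 ha).2 (Finset.mem_filter.1 hb).2
    obtain ⟨B, hB, hlt⟩ := hbs.2 C hC (hHC (Finset.mem_filter.2 ⟨hbs.1, hb⟩))
    have hGv : ∀ y ∈ G, Valid P y := by
      intro y hy
      rcases Finset.mem_insert.1 hy with rfl | hy
      exacts [hxv, hl.valid_of_known (hl.known_of_head hy)]
    rw [fit_eq_card hE fun y hy => hGv y (hC.subset hy),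
      fit_eq_card hE fun y hy => hGv y (hB.1.subset hy)] at hlt
    have hcard := Finset.card_le_card hHC
    have h1 := card_add_le (H := H) hB.1.subset (F := P.threshold) (by omega)
    obtain ⟨v, hv1, hv2, hv3⟩ := hH.exists_slotsFrom (Z := Z) (B := B) (G := G)
      (fun y hy hyH => by
        refine ⟨hGv y (hB.1.subset hy), ?_⟩
        rcases Finset.mem_insert.1 (hB.1.subset hy) with rfl | hy
        · exact ⟨hxm, hxs.resolve_left hyH⟩
        · have : y ∈ l := (hl.known_of_head hy).resolve_left
            (by rintro ⟨τ, rfl⟩; exact hyH (hH.genesis_mem τ))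
          exact ⟨hl.slot_le y this, (hl.selected y this).resolve_left hyH⟩)
      (fun a ha b hb => hB.1.compat ha hb)
      (fun y hy hym => by
        rcases hl.mem_final_or_head hy (hl.delivered y hy hym) with h | h
        · right
          intro z hz
          rcases Finset.mem_insert.1 (hB.1.subset hz) with rfl | hz
          · exact fun hi => ha.2 y h hi.symm
          · exact (hl.sound.compat y h z (Or.inr hz)).symm
        · exact Or.inl (Finset.mem_insert_of_mem h))
    refine ⟨v, hv1, by omega, ?_⟩
    have := Finset.card_filter_le (slotsFrom m v) (· ∈ Z)
    nlinarith
  · rw [step_of_not_accepted ha] at hbs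
    rcases Finset.mem_insert.1 hbs with rfl | h
    · unfold Accepted at ha
      rw [not_not] at ha
      -- Parents of `b` are honest and not stale, so `b` must conflict with a final block, which is
      -- then foreign.
      rcases ha with ⟨τ, p, hp, hps⟩ | ⟨f, hf, hi⟩
      · exact absurd hps (hl.not_stale p (hH.parent_mem b hb τ p hp).1)
      · exact hl.bad_of_final_notMem hH hE hf fun hfH => hH.compat hfH hb hi
    · exact absurd h hb0

/-- If the blockclique of a node is incompatible with a final block, the attacker was lucky. -/
theorem bad_of_incompat_final (hl : HonestLog P m Z H l) (hl' : HonestLog P m Z H l')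
    (hH : HonestChain P m S H) (hE : P.E = 0) {f b' : Block T}
    (hf : f ∈ (nodeState P l).final) (hb' : (nodeState P l').InBlockclique b')
    (hi : Incompat f b') : Bad T m P.threshold (6 * T) S Z := by
  by_cases hfH : f ∉ H
  · exact hl.bad_of_final_notMem hH hE hf hfH
  rw [not_not] at hfH
  have hbH : b' ∉ H := fun h => hH.compat hfH h hi
  rcases hb' with hb' | ⟨B, hB, hb'⟩
  · exact hl'.bad_of_final_notMem hH hE hb' hbH
  have hT : 0 < T := f.thread.pos
  set G := (nodeState P l').head
  have hGv : ∀ y ∈ G, Valid P y := fun y hy => hl'.valid_of_known (hl'.known_of_head hy)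
  -- Honest blocks of these slots descend from `f` and have been delivered. They inherit the
  -- conflict with `b'`, so the second node keeps them unsettled and outside `B`.
  set s : Finset ℕ := {k ∈ Finset.range (m + 1) | k ∈ S ∧ f.slot + T ≤ k ∧ k + T ≤ m} with hs
  have hsle : s.card ≤ ({b ∈ G | b ∈ H ∧ b ∉ B}).card := by
    have : s ⊆ ({b ∈ G | b ∈ H ∧ b ∉ B}).image slot := by
      intro k hk
      obtain ⟨-, hkS, h1, h2⟩ := Finset.mem_filter.1 hk
      obtain ⟨b, hb, rfl⟩ := hH.exists_block k hkS
      have hfb := hH.anc_of_add_le hfH hb h1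
      have hbb' : ¬ Compat b b' := fun hc =>
        (hGv b' (hB.1.subset hb')).compat_anc hc hfb hi
      refine Finset.mem_image.2 ⟨b, Finset.mem_filter.2 ⟨?_, hb, ?_⟩, rfl⟩
      · refine (hl'.mem_final_or_head hb (hl'.delivered b hb h2)).resolve_left fun h => ?_
        exact hbb' (hl'.sound.compat b h b' (Or.inr (hB.1.subset hb')))
      · exact fun hbB => hbb' (hB.1.compat hbB hb')
    exact (Finset.card_le_card this).trans Finset.card_image_le
  -- If `s` is large, `B` must contain at least as many foreign blocks to be best, so its segments
  -- are long. If `s` is small, few of the more than F descendants of `f` can be honest.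
  by_cases hF : P.threshold ≤ 3 * s.card
  · obtain ⟨C, hC, hHC⟩ := exists_isClique (S := G) (D := {b ∈ G | b ∈ H})
      (Finset.filter_subset _ _) fun a ha b hb =>
        hH.compat (Finset.mem_filter.1 ha).2 (Finset.mem_filter.1 hb).2
    have hle := hB.2 C hC
    rw [fit_eq_card hE fun y hy => hGv y (hC.subset hy),
      fit_eq_card hE fun y hy => hGv y (hB.1.subset hy)] at hle
    have hcard := Finset.card_le_card hHC
    have h1 := card_add_le (H := H) hB.1.subset (F := 0) (by omega)
    obtain ⟨v, hv1, hv2, hv3⟩ := hH.exists_slotsFrom (Z := Z) (B := B) (G := G)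
      (fun y hy hyH => by
        have : y ∈ l' := (hl'.known_of_head (hB.1.subset hy)).resolve_left
          (by rintro ⟨τ, rfl⟩; exact hyH (hH.genesis_mem τ))
        exact ⟨hl'.valid y this, hl'.slot_le y this, (hl'.selected y this).resolve_left hyH⟩)
      (fun a ha b hb => hB.1.compat ha hb)
      (fun y hy hym => by
        rcases hl'.mem_final_or_head hy (hl'.delivered y hy hym) with h | h
        · exact Or.inr fun z hz => (hl'.sound.compat y h z (Or.inr (hB.1.subset hz))).symm
        · exact Or.inl h)
    refine ⟨v, hv1, by omega, ?_⟩
    have := Finset.card_filter_le (slotsFrom m v) (· ∈ Z)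
    nlinarith
  · choose y hy1 hy2 using fun σ => exists_separating (P := P) hH hfH σ
    let v : Fin T → ℕ := fun σ => y σ + 1
    have hdesc : P.threshold <
        ({k ∈ slotsFrom m v | k ∈ Z} ∪ {k ∈ slotsFrom m v | k ∈ S}).card := by
      refine hl.threshold_lt_card hE hf fun d hd hfd => ?_
      have : d.slot ∈ slotsFrom m v :=
        slot_mem_slotsFrom.2 ⟨hl.slot_le d hd, hy1 _ d (hl.valid d hd) hfd rfl⟩
      rw [Finset.mem_union, Finset.mem_filter, Finset.mem_filter]
      rcases hl.selected d hd with h | h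
      · exact Or.inr ⟨this, hH.slot_mem d h (hl.ne_genesis d hd)⟩
      · exact Or.inl ⟨this, h⟩
    -- The excess over `s` comes from the last `T` slots and fewer than 2T slots around `f`.
    -- Doubling this 3T gives the constant 6T: honest and Byzantine slots together exceed F, which
    -- is more than `2 * s.card`.
    have hhon : ({k ∈ slotsFrom m v | k ∈ S}).card ≤ s.card + T + 2 * T := by
      have hsub : {k ∈ slotsFrom m v | k ∈ S} ⊆
          s ∪ {k ∈ Finset.range (m + 1) | m < k + T} ∪
            Finset.Ico (f.slot + 1 - T) (f.slot + T) := by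
        intro k hk
        rw [Finset.mem_filter] at hk
        obtain ⟨b, hb, rfl⟩ := hH.exists_block k hk.2
        have h1 := slot_mem_slotsFrom.1 hk.1
        have h2 := hy2 _ b hb hk.2 rfl h1.2
        simp only [hs, Finset.mem_union, Finset.mem_filter, Finset.mem_range, Finset.mem_Ico, hk.2,
          true_and]
        omega
      have h1 := HonestChain.card_late_le (T := T) m {k ∈ Finset.range (m + 1) | m < k + T}
        fun k hk => by
          rw [Finset.mem_filter, Finset.mem_range] at hk
          omega
      have h2 := Finset.card_le_card hsub
      have h3 := Finset.card_union_le (s ∪ {k ∈ Finset.range (m + 1) | m < k + T})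
        (Finset.Ico (f.slot + 1 - T) (f.slot + T))
      have h4 := Finset.card_union_le s {k ∈ Finset.range (m + 1) | m < k + T}
      rw [Nat.card_Ico] at h3
      omega
    have hu := Finset.card_union_le {k ∈ slotsFrom m v | k ∈ Z} {k ∈ slotsFrom m v | k ∈ S}
    have hu' : ({k ∈ slotsFrom m v | k ∈ Z} ∪ {k ∈ slotsFrom m v | k ∈ S}).card ≤
        (slotsFrom m v).card :=
      Finset.card_le_card (Finset.union_subset (Finset.filter_subset _ _)
        (Finset.filter_subset _ _))
    refine ⟨v, fun σ => Nat.le_add_left 1 _, by omega, by nlinarith⟩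

end HonestLog
end Blockclique

namespace Blockclique
open Classical
open MeasureTheory ProbabilityTheory
open scoped ENNReal

variable {N : Type*}

/-! ### The random selection -/

/-- Slots of Byzantine nodes count `x`, those used by honest nodes `x⁻¹`. -/
noncomputable def Network.weight (W : Network N) (x : ℝ) (p : N × Bool) : ℝ≥0∞ :=
  if p.1 ∈ W.byz then ENNReal.ofReal x else if p.2 = false then ENNReal.ofReal x⁻¹ else 1

theorem lintegral_bernoulliMeasure_bool (μ : unitInterval) (f : Bool → ℝ≥0∞) :
    ∫⁻ b, f b ∂(bernoulliMeasure true false μ) =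
      ENNReal.ofReal μ * f true + ENNReal.ofReal (1 - μ) * f false := by
  rw [bernoulliMeasure_def, lintegral_add_measure, lintegral_smul_measure, lintegral_smul_measure,
    lintegral_dirac, lintegral_dirac]
  have h1 : ((unitInterval.toNNReal μ : NNReal) : ℝ≥0∞) = ENNReal.ofReal μ := by
    rw [ENNReal.ofReal]
    congr 1
    ext
    simp [μ.2.1]
  have h2 : ((unitInterval.toNNReal (unitInterval.symm μ) : NNReal) : ℝ≥0∞) =
      ENNReal.ofReal (1 - μ) := by
    rw [ENNReal.ofReal]
    congr 1
    ext
    simp [μ.2.2]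
  rw [← h1, ← h2]
  rfl

theorem Network.prod_weight (W : Network N) {x : ℝ} (hx : 0 < x) (A : Finset ℕ)
    (ω : ℕ → N × Bool) :
    ∏ k ∈ A, W.weight x (ω k) =
      ENNReal.ofReal (x ^ ({k ∈ A | (ω k).1 ∈ W.byz}).card *
        x⁻¹ ^ ({k ∈ A | (ω k).1 ∉ W.byz ∧ (ω k).2 = false}).card) := by
  have hxi : 0 < x⁻¹ := inv_pos.2 hx
  induction A using Finset.induction_on with
  | empty => simp
  | insert a A ha ih =>
    rw [Finset.prod_insert ha, ih, Finset.filter_insert, Finset.filter_insert]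
    by_cases h1 : (ω a).1 ∈ W.byz
    · rw [Network.weight, if_pos h1, if_pos h1, if_neg (by tauto),
        Finset.card_insert_of_notMem (fun h => ha (Finset.mem_filter.1 h).1),
        ← ENNReal.ofReal_mul hx.le]
      congr 1
      ring
    · by_cases h2 : (ω a).2 = false
      · rw [Network.weight, if_neg h1, if_pos h2, if_neg h1, if_pos ⟨h1, h2⟩,
          Finset.card_insert_of_notMem (fun h => ha (Finset.mem_filter.1 h).1),
          ← ENNReal.ofReal_mul hxi.le]
        congr 1
        ring
      · rw [Network.weight, if_neg h1, if_neg h2, if_neg h1, if_neg (by tauto), one_mul]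

section

variable [Fintype N] [MeasurableSpace N] [MeasurableSingletonClass N]

/-- The mean is affine and increasing in the Byzantine share, because an honest node contributes at
most 1 ≤ x on average; so the share β is the worst case. -/
theorem Network.lintegral_weight_le (W : Network N) {x β : ℝ} (hx : 1 ≤ x) (hβ : 0 ≤ β)
    {ν : Measure N} [IsProbabilityMeasure ν] (h : ν W.byz ≤ ENNReal.ofReal β) :
    ∫⁻ p, W.weight x p ∂(ν.prod (bernoulliMeasure true false W.μ)) ≤
      ENNReal.ofReal (x * β + (W.μ + (1 - W.μ) * x⁻¹) * (1 - β)) := by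
  have hμ0 := W.μ.2.1
  have hμ1 := W.μ.2.2
  have hx0 : 0 < x := by linarith
  have hxi : x⁻¹ ≤ 1 := inv_le_one_of_one_le₀ hx
  have hxi0 : 0 ≤ x⁻¹ := by positivity
  set K : ℝ := W.μ + (1 - W.μ) * x⁻¹ with hK
  have hK0 : 0 ≤ K := by nlinarith
  have hK1 : K ≤ 1 := by nlinarith
  rw [lintegral_prod _ (measurable_of_finite _).aemeasurable]
  have hinner : ∀ n, ∫⁻ b, W.weight x (n, b) ∂(bernoulliMeasure true false W.μ) =
      W.byz.indicator (fun _ => ENNReal.ofReal x) n +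
        W.byzᶜ.indicator (fun _ => ENNReal.ofReal K) n := by
    intro n
    rw [lintegral_bernoulliMeasure_bool]
    by_cases hn : n ∈ W.byz
    · simp only [Network.weight, hn, if_true, Set.indicator_of_mem, Set.mem_compl_iff,
        not_true_eq_false, not_false_eq_true, Set.indicator_of_notMem, add_zero]
      rw [← add_mul, ← ENNReal.ofReal_add hμ0 (by linarith)]
      simp
    · simp only [Network.weight, hn, if_false, if_true, Set.mem_compl_iff, not_false_eq_true,
        Set.indicator_of_mem, Set.indicator_of_notMem, zero_add, Bool.true_eq_false, mul_one]
      rw [← ENNReal.ofReal_mul (by linarith), ← ENNReal.ofReal_add hμ0 (by nlinarith)]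
  simp_rw [hinner]
  have hms : MeasurableSet W.byz := W.byz.toFinite.measurableSet
  rw [lintegral_add_left (measurable_of_finite _), lintegral_indicator_const hms,
    lintegral_indicator_const hms.compl, prob_compl_eq_one_sub hms]
  have hp : ν W.byz = ENNReal.ofReal (ν.real W.byz) := by
    rw [Measure.real, ENNReal.ofReal_toReal (measure_ne_top _ _)]
  have hp0 : 0 ≤ ν.real W.byz := measureReal_nonneg
  have hp1 : ν.real W.byz ≤ 1 := measureReal_le_one
  have hpβ : ν.real W.byz ≤ β := by
    rw [hp] at h
    exact (ENNReal.ofReal_le_ofReal_iff hβ).1 h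
  rw [hp, ← ENNReal.ofReal_one, ← ENNReal.ofReal_sub _ hp0, ← ENNReal.ofReal_mul hx0.le,
    ← ENNReal.ofReal_mul hK0, ← ENNReal.ofReal_add (by positivity) (by nlinarith)]
  apply ENNReal.ofReal_le_ofReal
  nlinarith

theorem Network.lintegral_prod_weight_le (W : Network N) {x ρ : ℝ}
    (h : ∀ k, ∫⁻ p, W.weight x p ∂((W.resource k).toMeasure.prod
      (bernoulliMeasure true false W.μ)) ≤ ENNReal.ofReal ρ) (A : Finset ℕ) :
    ∫⁻ ω, ∏ k ∈ A, W.weight x (ω k) ∂W.selection ≤ ENNReal.ofReal ρ ^ A.card := by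
  unfold Network.selection
  have hm : Measurable (W.weight x) := measurable_of_finite _
  refine (lintegral_prod_eq_prod_lintegral_of_indepFun A (fun k (ω : ℕ → N × Bool) => W.weight x (ω k))
    (iIndepFun_infinitePi (X := fun (_ : ℕ) => W.weight x) fun _ => hm)
    fun k => hm.comp (measurable_pi_apply k)).trans_le ?_
  refine (Finset.prod_le_pow_card _ _ _ fun k _ => ?_)
  refine le_of_eq_of_le ?_ (h k)
  rw [← (measurePreserving_eval_infinitePi (fun k => (W.resource k).toMeasure.prod
      (bernoulliMeasure true false W.μ)) k).lintegral_comp hm]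

/-- Markov's inequality for the product of the weights: on this event it is at least x^(-c), and by
independence its mean is at most ρ^|A|. -/
theorem Network.measure_honest_le_byz_le (W : Network N) {x ρ : ℝ} (hx : 1 ≤ x) (hρ : 0 ≤ ρ)
    (h : ∀ k, ∫⁻ p, W.weight x p ∂((W.resource k).toMeasure.prod
      (bernoulliMeasure true false W.μ)) ≤ ENNReal.ofReal ρ) (A : Finset ℕ) (c : ℕ) :
    W.selection {ω | ({k ∈ A | (ω k).1 ∉ W.byz ∧ (ω k).2 = false}).card ≤
      ({k ∈ A | (ω k).1 ∈ W.byz}).card + c} ≤ ENNReal.ofReal (x ^ c * ρ ^ A.card) := by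
  have hx0 : 0 < x := by linarith
  have hmeas : Measurable fun ω : ℕ → N × Bool => ∏ k ∈ A, W.weight x (ω k) :=
    Finset.measurable_prod _ fun k _ =>
      (measurable_of_finite (W.weight x)).comp (measurable_pi_apply k)
  calc _ ≤ W.selection {ω | ENNReal.ofReal ((x ^ c)⁻¹) ≤ ∏ k ∈ A, W.weight x (ω k)} := by
        refine measure_mono fun ω hω => ?_
        simp only [Set.mem_ofPred_eq] at hω ⊢
        rw [W.prod_weight hx0]
        apply ENNReal.ofReal_le_ofReal
        rw [inv_pow, inv_le_iff_one_le_mul₀ (by positivity), mul_right_comm, ← pow_add,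
          ← div_eq_mul_inv, one_le_div (by positivity)]
        exact pow_le_pow_right₀ hx hω
    _ ≤ (∫⁻ ω, ∏ k ∈ A, W.weight x (ω k) ∂W.selection) / ENNReal.ofReal ((x ^ c)⁻¹) :=
        meas_ge_le_lintegral_div hmeas.aemeasurable
          (by simp only [ne_eq, ENNReal.ofReal_eq_zero, not_le]; positivity) ENNReal.ofReal_ne_top
    _ ≤ ENNReal.ofReal ρ ^ A.card / ENNReal.ofReal ((x ^ c)⁻¹) :=
        ENNReal.div_le_div_right (W.lintegral_prod_weight_le h A) _
    _ = _ := by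
        rw [← ENNReal.ofReal_pow hρ, ← ENNReal.ofReal_div_of_pos (by positivity), div_inv_eq_mul,
          mul_comm]

end

/-! ### Unions over all segments of slots -/

/-- Row `m / T` may be incomplete, so only the rows below it are counted. -/
theorem sum_le_card_slotsFrom {T : ℕ} (m : ℕ) (v : Fin T → ℕ) :
    ∑ τ, (m / T - v τ) ≤ (slotsFrom m v).card := by
  have : ∑ τ, (m / T - v τ) = (Finset.univ.sigma fun τ => Finset.Ico (v τ) (m / T)).card := by
    simp [Finset.card_sigma]
  rw [this]
  have hdiv : ∀ (τ : Fin T) (i : ℕ), (i * T + τ) / T = i ∧ (i * T + τ) % T = τ := by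
    intro τ i
    rw [Nat.mul_comm, Nat.mul_add_div τ.pos, Nat.div_eq_of_lt τ.2, Nat.mul_add_mod,
      Nat.mod_eq_of_lt τ.2]
    exact ⟨rfl, rfl⟩
  refine Finset.card_le_card_of_injOn (fun p => p.2 * T + p.1) ?_ ?_
  · rintro ⟨τ, i⟩ h
    simp only [Finset.coe_sigma, Set.mem_sigma_iff, Finset.coe_univ, Set.mem_univ, true_and,
      Finset.coe_Ico, Set.mem_Ico] at h
    simp only [slotsFrom, Finset.mem_coe, Finset.mem_filter, Finset.mem_range]
    refine ⟨?_, τ, (hdiv τ i).2, (hdiv τ i).1.symm ▸ h.1⟩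
    have h1 : (i + 1) * T ≤ m := (Nat.mul_le_mul_right T h.2).trans (Nat.div_mul_le_self _ _)
    have := τ.2
    linarith
  · rintro ⟨τ, i⟩ _ ⟨σ, j⟩ _ h
    simp only at h
    have h1 := hdiv τ i
    rw [h] at h1
    have hij : i = j := h1.1.symm.trans (hdiv σ j).1
    have hτσ : τ = σ := Fin.ext (h1.2.symm.trans (hdiv σ j).2)
    rw [hij, hτσ]

/-- Starting points beyond the last row all give an empty segment, which leaves finitely many `v`
for the union bound. -/
theorem slotsFrom_min {T : ℕ} (m : ℕ) (v : Fin T → ℕ) :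
    slotsFrom m (fun τ => min (v τ) (m / T + 1)) = slotsFrom m v := by
  ext k
  simp only [slotsFrom, Finset.mem_filter, Finset.mem_range]
  refine and_congr_right fun hk => exists_congr fun τ => and_congr_right fun _ => ?_
  have : k / T ≤ m / T := Nat.div_le_div_right (by omega)
  omega

theorem sum_pow_le {r : ℝ} (hr0 : 0 ≤ r) (hr1 : r < 1) (M : ℕ) :
    ∑ n ∈ Finset.range (M + 2), r ^ (M - n) ≤ (1 - r)⁻¹ + 1 := by
  -- The index `M + 1` stands for an empty segment; by truncated subtraction it contributes the
  -- summand 1.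
  rw [Finset.sum_range_succ]
  have h1 : ∑ n ∈ Finset.range (M + 1), r ^ (M - n) = ∑ n ∈ Finset.range (M + 1), r ^ n := by
    rw [← Finset.sum_range_reflect]
    refine Finset.sum_congr rfl fun n hn => ?_
    have := Finset.mem_range.1 hn
    congr 1
    omega
  rw [h1, show M - (M + 1) = 0 by omega, pow_zero]
  gcongr
  rw [← tsum_geometric_of_lt_one hr0 hr1]
  exact (summable_geometric_of_lt_one hr0 hr1).sum_le_tsum _ fun n _ => pow_nonneg hr0 n

theorem sum_pow_card_slotsFrom_le (T m : ℕ) {r : ℝ} (hr0 : 0 < r) (hr1 : r < 1) :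
    ∑ v ∈ Fintype.piFinset fun _ : Fin T => Finset.range (m / T + 2),
      r ^ (slotsFrom m v).card ≤ ((1 - r)⁻¹ + 1) ^ T := by
  calc _ ≤ ∑ v ∈ Fintype.piFinset fun _ : Fin T => Finset.range (m / T + 2),
        ∏ τ, r ^ (m / T - v τ) := by
        refine Finset.sum_le_sum fun v _ => ?_
        rw [Finset.prod_pow_eq_pow_sum]
        exact pow_le_pow_of_le_one hr0.le hr1.le (sum_le_card_slotsFrom m v)
    _ = ∏ _τ : Fin T, ∑ n ∈ Finset.range (m / T + 2), r ^ (m / T - n) :=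
        (Finset.prod_univ_sum (fun _ : Fin T => Finset.range (m / T + 2))
          fun _ n => r ^ (m / T - n)).symm
    _ ≤ ∏ _τ : Fin T, ((1 - r)⁻¹ + 1) :=
        Finset.prod_le_prod (fun _ _ => Finset.sum_nonneg fun _ _ => pow_nonneg hr0.le _)
          fun _ _ => sum_pow_le hr0.le hr1 _
    _ = _ := by simp

/-- The segments of slots in which the attacker is lucky are exponentially unlikely. -/
theorem exists_measure_bad_le (T : ℕ) {β : ℝ} (hβ : 0 ≤ β) (μ : unitInterval)
    (h : β < (1 - β) * (1 - (μ : ℝ))) {c : ℕ} (hc : 0 < c) :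
    ∃ C > (0 : ℝ), ∃ a > (0 : ℝ), ∀ (N : Type*) [Fintype N] [MeasurableSpace N]
      [MeasurableSingletonClass N] (W : Network N), W.μ = μ →
      (∀ k, (W.resource k).toMeasure W.byz ≤ ENNReal.ofReal β) → ∀ m F : ℕ,
        W.selection {ω | Bad T m F c {k | HonestSlot T W ω k ∧ k ≤ m} {k | (ω k).1 ∈ W.byz}} ≤
          ENNReal.ofReal (C * Real.exp (-a * F)) := by
  have hμ0 := μ.2.1
  have hμ1 := μ.2.2
  set γ : ℝ := (1 - β) * (1 - (μ : ℝ)) with hγ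
  -- Any x > 1 with xβ < γ would do, since 1 - ρ = (x - 1)(γ/x - β) for the ρ below.
  set x : ℝ := (γ + 1) / (β + 1) with hx
  have hx1 : 1 < x := by rw [hx, one_lt_div (by linarith)]; linarith
  have hxβ : x * β < γ := by
    rw [hx, div_mul_eq_mul_div, div_lt_iff₀ (by linarith)]
    nlinarith
  set ρ : ℝ := x * β + (μ + (1 - μ) * x⁻¹) * (1 - β) with hρ
  have hγ0 : 0 < γ := by linarith
  have hxi : 0 < x⁻¹ := by positivity
  have hρ' : ρ = x * β + μ * (1 - β) + γ * x⁻¹ := by rw [hρ, hγ]; ring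
  have hβ1 : β ≤ 1 := by
    by_contra hlt
    have : γ ≤ 0 := mul_nonpos_of_nonpos_of_nonneg (by linarith) (by linarith)
    linarith
  have hρ0 : 0 < ρ := by
    rw [hρ']
    have : 0 ≤ (μ : ℝ) * (1 - β) := mul_nonneg hμ0 (by linarith)
    positivity
  have hρ1 : ρ < 1 := by
    have h1 : (1 : ℝ) = β + μ * (1 - β) + γ := by rw [hγ]; ring
    have h2 : (x - 1) * (γ * x⁻¹ - β) > 0 := by
      apply mul_pos (by linarith)
      rw [sub_pos, ← div_eq_mul_inv, lt_div_iff₀ (by linarith)]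
      linarith
    have h3 : x * x⁻¹ = 1 := mul_inv_cancel₀ (by linarith)
    have h4 : (x - 1) * (γ * x⁻¹ - β) = γ - γ * x⁻¹ - x * β + β := by
      linear_combination γ * h3
    rw [hρ']
    linarith
  -- In ρ^n = r^n · r^n one factor gives the decay in F, through F ≤ c(n + 1), and the other makes
  -- the sum over starting points converge.
  set r : ℝ := Real.sqrt ρ with hr
  have hr0 : 0 < r := Real.sqrt_pos.2 hρ0
  have hr1 : r < 1 := by rw [hr, Real.sqrt_lt' one_pos]; simpa using hρ1
  have hrr : r * r = ρ := Real.mul_self_sqrt hρ0.le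
  set b : ℝ := -Real.log r with hb
  have hb0 : 0 < b := by rw [hb]; linarith [Real.log_neg hr0 hr1]
  have hrb : r = Real.exp (-b) := by rw [hb, neg_neg, Real.exp_log hr0]
  have hr1' : 0 < (1 - r)⁻¹ := inv_pos.2 (by linarith)
  have hc0 : (0 : ℝ) < c := by exact_mod_cast hc
  refine ⟨x ^ c * Real.exp b * ((1 - r)⁻¹ + 1) ^ T, by positivity, b / c, by positivity, ?_⟩
  intro N _ _ _ W hWμ hW m F
  have hw : ∀ k, ∫⁻ p, W.weight x p ∂((W.resource k).toMeasure.prod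
      (bernoulliMeasure true false W.μ)) ≤ ENNReal.ofReal ρ := by
    intro k
    rw [hρ, ← hWμ]
    exact W.lintegral_weight_le hx1.le hβ (hW k)
  set I := Fintype.piFinset fun _ : Fin T => Finset.range (m / T + 2) with hI
  set J := {v ∈ I | F ≤ c * ((slotsFrom m v).card + 1)} with hJ
  let E : (Fin T → ℕ) → Set (ℕ → N × Bool) := fun v =>
    {ω | ({k ∈ slotsFrom m v | (ω k).1 ∉ W.byz ∧ (ω k).2 = false}).card ≤
      ({k ∈ slotsFrom m v | (ω k).1 ∈ W.byz}).card + c}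
  have hsub : {ω | Bad T m F c {k | HonestSlot T W ω k ∧ k ≤ m} {k | (ω k).1 ∈ W.byz}} ⊆
      ⋃ v ∈ J, E v := by
    rintro ω ⟨v, hv1, hv2, hv3⟩
    simp only [Set.mem_iUnion]
    refine ⟨fun τ => min (v τ) (m / T + 1), ?_, ?_⟩
    · rw [hJ, Finset.mem_filter, slotsFrom_min]
      refine ⟨?_, hv3⟩
      rw [hI, Fintype.mem_piFinset]
      intro τ
      rw [Finset.mem_range]
      omega
    · simp only [E, Set.mem_ofPred_eq, slotsFrom_min]
      refine le_trans (Finset.card_le_card fun k hk => ?_) hv2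
      simp only [Finset.mem_filter] at hk ⊢
      refine ⟨hk.1, ⟨?_, hk.2⟩, ?_⟩
      -- As `1 ≤ v τ`, the segments avoid the genesis slots, so the condition `T ≤ k` in
      -- `HonestSlot` is automatic.
      · obtain ⟨τ, -, h2⟩ := (Finset.mem_filter.1 hk.1).2
        have h3 := (hv1 τ).trans h2
        exact (Nat.le_mul_of_pos_left T h3).trans (Nat.div_mul_le_self k T)
      · have := Finset.mem_range.1 (Finset.mem_filter.1 hk.1).1
        omega
  have hterm : ∀ v ∈ J, x ^ c * ρ ^ (slotsFrom m v).card ≤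
      x ^ c * Real.exp b * Real.exp (-(b / c) * F) * r ^ (slotsFrom m v).card := by
    intro v hv
    have h1 : (F : ℝ) ≤ c * ((slotsFrom m v).card + 1) := by
      exact_mod_cast (Finset.mem_filter.1 hv).2
    have h2 : r ^ (slotsFrom m v).card ≤ Real.exp b * Real.exp (-(b / c) * F) := by
      rw [← Real.exp_add, hrb, ← Real.exp_nat_mul]
      apply Real.exp_le_exp.2
      have h3 : b / c * F ≤ b / c * (c * ((slotsFrom m v).card + 1)) := by gcongr
      have h4 : b / c * (c * (((slotsFrom m v).card : ℝ) + 1)) =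
          b * ((slotsFrom m v).card + 1) := by rw [← mul_assoc, div_mul_cancel₀ _ hc0.ne']
      linarith
    rw [← hrr, mul_pow, mul_assoc (x ^ c), mul_assoc (x ^ c)]
    gcongr
  calc _ ≤ W.selection (⋃ v ∈ J, E v) := measure_mono hsub
    _ ≤ ∑ v ∈ J, W.selection (E v) := measure_biUnion_finset_le J E
    _ ≤ ∑ v ∈ J, ENNReal.ofReal (x ^ c * ρ ^ (slotsFrom m v).card) :=
        Finset.sum_le_sum fun v _ => W.measure_honest_le_byz_le hx1.le hρ0.le hw _ c
    _ = ENNReal.ofReal (∑ v ∈ J, x ^ c * ρ ^ (slotsFrom m v).card) :=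
        (ENNReal.ofReal_sum_of_nonneg fun v _ => by positivity).symm
    _ ≤ _ := by
        apply ENNReal.ofReal_le_ofReal
        calc _ ≤ ∑ v ∈ J, x ^ c * Real.exp b * Real.exp (-(b / c) * F) *
              r ^ (slotsFrom m v).card := Finset.sum_le_sum hterm
          _ ≤ ∑ v ∈ I, x ^ c * Real.exp b * Real.exp (-(b / c) * F) *
              r ^ (slotsFrom m v).card :=
              Finset.sum_le_sum_of_subset_of_nonneg (Finset.filter_subset _ _)
                fun v _ _ => by positivity
          _ = x ^ c * Real.exp b * Real.exp (-(b / c) * F) *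
              ∑ v ∈ I, r ^ (slotsFrom m v).card := by rw [Finset.mul_sum]
          _ ≤ x ^ c * Real.exp b * Real.exp (-(b / c) * F) * ((1 - r)⁻¹ + 1) ^ T := by
              gcongr
              exact sum_pow_card_slotsFrom_le T m hr0 hr1
          _ = _ := by ring

end Blockclique

namespace Blockclique
open Classical

/-! ### Executions under attack -/

section Executions

variable {T : ℕ} {P : Params T} {N : Type*} {W : Network N} {ω : ℕ → N × Bool} {X : Trace T N}

theorem Params.slotTime_mono (ht : 0 < P.t₀) {k k' : ℕ} (h : k ≤ k') :
    P.slotTime k ≤ P.slotTime k' := by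
  unfold Params.slotTime
  gcongr

theorem Params.slotTime_nonneg (ht : 0 < P.t₀) (k : ℕ) : 0 ≤ P.slotTime k := by
  unfold Params.slotTime
  positivity

theorem Params.slotTime_le_iff (ht : 0 < P.t₀) (hT : 0 < T) {k : ℕ} {u : ℝ} :
    P.slotTime k ≤ u ↔ (k : ℝ) ≤ u * T / P.t₀ := by
  unfold Params.slotTime
  rw [div_le_iff₀ (by exact_mod_cast hT), le_div_iff₀ ht]

theorem Params.slotTime_add_le (ht : 0 < P.t₀) (hT : 0 < T) {k k' : ℕ} (h : k + T ≤ k') :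
    P.slotTime k + P.t₀ ≤ P.slotTime k' := by
  have hT' : (0 : ℝ) < T := by exact_mod_cast hT
  have h' : (k : ℝ) + T ≤ k' := by exact_mod_cast h
  have : P.slotTime k + P.t₀ = (k + T) * P.t₀ / T := by
    unfold Params.slotTime
    field_simp
  rw [this]
  unfold Params.slotTime
  gcongr

namespace Trace

/-- The genesis blocks and the blocks of honest nodes up to slot `m`. -/
def honestSet (X : Trace T N) (W : Network N) (ω : ℕ → N × Bool) (m : ℕ) : Set (Block T) :=
  {b | (∃ τ, b = .genesis τ) ∨
    (HonestSlot T W ω b.slot ∧ b.slot ≤ m ∧ b = X.honestBlock b.slot)}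

namespace Admissible

variable {m : ℕ}

theorem eq_honestBlock (hX : X.Admissible P W ω) {n : N} (hn : n ∉ W.byz) {u : ℝ} {b : Block T}
    (hb : b ∈ X.log n u) (hs : HonestSlot T W ω b.slot) : b = X.honestBlock b.slot :=
  ((hX.log_selected n hn u b hb).resolve_left hs.2.1).2

theorem honest_mem_log (hX : X.Admissible P W ω) (ht : 0 < P.t₀)
    (hno : ∀ u < P.slotTime m, ¬ X.AttackSuccess P W ω u) {k : ℕ} (hk : HonestSlot T W ω k)
    (hkm : k ≤ m) {n : N} (hn : n ∉ W.byz) {u : ℝ}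
    (h : P.slotTime k + W.δ ≤ u ∨ n = (ω k).1 ∧ P.slotTime k ≤ u) :
    X.honestBlock k ∈ X.log n u :=
  hX.honest_delivery k hk
    (fun v hv => hno v (hv.trans_le (Params.slotTime_mono ht hkm))) n hn u h

theorem exists_honestBlock (hX : X.Admissible P W ω) (ht : 0 < P.t₀)
    (hno : ∀ u < P.slotTime m, ¬ X.AttackSuccess P W ω u) {k : ℕ} (hk : HonestSlot T W ω k)
    (hkm : k ≤ m) : (X.honestBlock k).slot = k ∧
      ∀ σ p, (X.honestBlock k).parent σ = some p → X.IsTip P W ω (ω k).1 k σ p := by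
  obtain ⟨τ, i, ps, e, content, h1, h2, -, -, h3⟩ := hX.honest_create k hk
    fun v hv => hno v (hv.trans_le (Params.slotTime_mono ht hkm))
  rw [h2]
  refine ⟨h1.symm, fun σ p hp => ?_⟩
  simp only [Block.parent, Option.some.injEq] at hp
  exact hp ▸ h3 σ

theorem honestChain (hX : X.Admissible P W ω) (ht : 0 < P.t₀) (hT : 0 < T)
    (hδ : W.δ < P.t₀ / 2) (hno : ∀ u < P.slotTime m, ¬ X.AttackSuccess P W ω u) :
    HonestChain P m {k | HonestSlot T W ω k ∧ k ≤ m} (X.honestSet W ω m) where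
  genesis_mem τ := Or.inl ⟨τ, rfl⟩
  valid := by
    rintro b (⟨τ, rfl⟩ | ⟨h1, h2, h3⟩)
    · exact Valid.genesis τ
    · have := hX.honest_mem_log ht hno h1 h2 h1.2.1 (Or.inr ⟨rfl, le_rfl⟩)
      rw [← h3] at this
      exact (hX.log_valid _ h1.2.1 _ b this).1
  parent_mem := by
    rintro b (⟨τ, rfl⟩ | ⟨h1, h2, h3⟩) σ p hp
    · simp [Block.parent] at hp
    · have htip := (hX.exists_honestBlock ht hno h1 h2).2 σ p (h3 ▸ hp)
      rcases htip.1.2 with rfl | ⟨h4, h5, h6⟩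
      · exact ⟨Or.inl ⟨σ, rfl⟩, (HonestChain.genesis_slot_lt σ).trans_le h1.1⟩
      · exact ⟨Or.inr ⟨h5, h6.le.trans h2, hX.eq_honestBlock h1.2.1 h4 h5⟩, h6⟩
  eq_of_slot_eq := by
    rintro a (⟨τ, rfl⟩ | ⟨h1, h2, h3⟩) b (⟨σ, rfl⟩ | ⟨h4, h5, h6⟩) hab
    · exact congrArg Block.genesis (Block.thread_eq_of_slot_eq hab)
    · have := HonestChain.genesis_slot_lt τ
      have := h4.1
      omega
    · have := HonestChain.genesis_slot_lt σ
      have := h1.1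
      omega
    · rw [h3, h6, hab]
  slot_mem := by
    rintro b (⟨τ, rfl⟩ | ⟨h1, h2, h3⟩) hg
    · exact absurd rfl (hg τ)
    · exact ⟨h1, h2⟩
  exists_block := by
    rintro k ⟨h1, h2⟩
    have hs := (hX.exists_honestBlock ht hno h1 h2).1
    exact ⟨X.honestBlock k, Or.inr (by rw [hs]; exact ⟨h1, h2, rfl⟩), hs⟩
  bounds k hk := ⟨hk.1.1, hk.2⟩
  -- Slots `T` apart are at least `t₀`, hence more than δ, apart in time, so `a` had reached the
  -- producer of `b`.
  tip := by
    rintro a ha b (⟨τ, rfl⟩ | ⟨h1, h2, h3⟩) hab p hp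
    · simp [Block.parent] at hp
    · have htip := (hX.exists_honestBlock ht hno h1 h2).2 a.thread p (h3 ▸ hp)
      refine htip.2 a ⟨rfl, ?_⟩
      rcases ha with ⟨τ, rfl⟩ | ⟨h4, h5, h6⟩
      · exact Or.inl rfl
      · refine Or.inr ⟨?_, h4, by omega⟩
        rw [h6]
        refine hX.honest_mem_log ht hno h4 h5 h1.2.1 (Or.inl ?_)
        have := Params.slotTime_add_le ht hT hab
        linarith

/-- A block at least one period before slot `m` arrives strictly before that slot, so any prefix
extending all earlier logs contains it. -/
theorem honestLog (hX : X.Admissible P W ω) (ht : 0 < P.t₀) (hT : 0 < T)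
    (hδ : W.δ < P.t₀ / 2) (hno : ∀ u < P.slotTime m, ¬ X.AttackSuccess P W ω u)
    {n : N} (hn : n ∉ W.byz) {u : ℝ} (hu : u < P.slotTime (m + 1)) {l : List (Block T)}
    (hl : l <+: X.log n u) (hl' : ∀ v < P.slotTime m, X.log n v <+: l)
    (hs : ∀ b ∈ X.honestSet W ω m, b ∉ (nodeState P l).stale) :
    HonestLog P m {k | (ω k).1 ∈ W.byz} (X.honestSet W ω m) l := by
  have hslot : ∀ b ∈ l, b.slot ≤ m := by
    intro b hb
    have h1 := (hX.log_time n hn u b (hl.subset hb)).trans_lt hu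
    by_contra hlt
    exact absurd (Params.slotTime_mono ht (show m + 1 ≤ b.slot by omega)) (not_le.2 h1)
  refine ⟨fun b hb => (hX.log_valid n hn u b (hl.subset hb)).1,
    fun b hb => (hX.log_valid n hn u b (hl.subset hb)).2, hslot, ?_, ?_, hs⟩
  · intro b hb
    rcases hX.log_selected n hn u b (hl.subset hb) with h | ⟨h1, h2⟩
    · exact Or.inr h
    · exact Or.inl (Or.inr ⟨h1, hslot b hb, h2⟩)
  · rintro b (hg | ⟨h1, h2, h3⟩) hb
    · exact Or.inl hg
    · right
      have h4 := Params.slotTime_add_le ht hT hb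
      refine (hl' (P.slotTime b.slot + W.δ) (by linarith)).subset ?_
      have := hX.honest_mem_log ht hno h1 h2 hn (Or.inl le_rfl)
      rwa [← h3] at this

theorem attackSuccess_of_mem_stale (hX : X.Admissible P W ω) {n : N} (hn : n ∉ W.byz) {u : ℝ}
    {b : Block T} (hb : b ∈ X.honestSet W ω m) (hs : b ∈ (X.state P n u).stale) :
    X.AttackSuccess P W ω u := by
  rcases hb with ⟨τ, rfl⟩ | ⟨h1, -, -⟩
  · exact absurd hs ((sound_nodeState fun b hb => (hX.log_valid n hn u b hb).2).genesis τ)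
  · exact Or.inl ⟨n, hn, b, hs, h1⟩

/-- Many blocks may be processed at the same instant, so the first failure is located in the log
rather than in time. -/
theorem exists_first_stale {H : Set (Block T)} {l : List (Block T)}
    (h : ∃ b ∈ H, b ∈ (nodeState P l).stale) :
    ∃ l' x, l' ++ [x] <+: l ∧ (∀ b ∈ H, b ∉ (nodeState P l').stale) ∧
      ∃ b ∈ H, b ∈ (nodeState P (l' ++ [x])).stale := by
  induction l using List.reverseRecOn with
  | nil => simp [nodeState, NodeState.init] at h
  | append_singleton l x ih =>
    by_cases hl : ∃ b ∈ H, b ∈ (nodeState P l).stale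
    · obtain ⟨l', y, h1, h2⟩ := ih hl
      exact ⟨l', y, h1.trans (List.prefix_append l [x]), h2⟩
    · push Not at hl
      exact ⟨l, x, List.prefix_rfl, hl, h⟩

/-- When an attack succeeds for the first time, the attacker has been lucky. -/
theorem bad_of_first_success (hX : X.Admissible P W ω) (ht : 0 < P.t₀) (hT : 0 < T)
    (hE : P.E = 0) (hδ : W.δ < P.t₀ / 2)
    (hno : ∀ u < P.slotTime m, ¬ X.AttackSuccess P W ω u) {u : ℝ} (hmu : P.slotTime m ≤ u)
    (hum : u < P.slotTime (m + 1)) (hu : X.AttackSuccess P W ω u) :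
    Bad T m P.threshold (6 * T) {k | HonestSlot T W ω k ∧ k ≤ m} {k | (ω k).1 ∈ W.byz} := by
  have hH := hX.honestChain ht hT hδ hno
  have hmono : ∀ n, n ∉ W.byz → ∀ v < P.slotTime m, X.log n v <+: X.log n u :=
    fun n hn v hv => hX.log_mono n hn v u (hv.le.trans hmu)
  by_cases hst : ∃ n, n ∉ W.byz ∧ ∃ b ∈ X.honestSet W ω m, b ∈ (X.state P n u).stale
  · obtain ⟨n, hn, hb⟩ := hst
    obtain ⟨l, x, h1, h2, b, hb, hbs⟩ := exists_first_stale hb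
    -- A log before slot `m` that reached `x` would already show a stale honest block, i.e. an
    -- earlier success.
    have hl : ∀ v < P.slotTime m, X.log n v <+: l := by
      intro v hv
      have key : ¬ l ++ [x] <+: X.log n v := fun h =>
        hno v hv (hX.attackSuccess_of_mem_stale hn hb (stale_subset_of_prefix h hbs))
      have h3 := (List.prefix_or_prefix_of_prefix h1 (hmono n hn v hv)).resolve_left key
      rcases List.prefix_concat_iff.1 h3 with h4 | h4
      · exact absurd (h4 ▸ List.prefix_rfl) key
      · exact h4
    have hlog := hX.honestLog ht hT hδ hno hn hum ((List.prefix_append l [x]).trans h1) hl h2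
    have hx : x ∈ X.log n u := h1.subset (by simp)
    rw [nodeState_concat] at hbs
    have hxm : x.slot ≤ m := by
      by_contra hlt
      have h3 := (hX.log_time n hn u x hx).trans_lt hum
      exact absurd (Params.slotTime_mono ht (show m + 1 ≤ x.slot by omega)) (not_le.2 h3)
    refine hlog.bad_of_mem_stale_step hH hE (hX.log_valid n hn u x hx).1 hxm ?_ hb hbs
    rcases hX.log_selected n hn u x hx with h | ⟨h3, h4⟩
    · exact Or.inr h
    · exact Or.inl (Or.inr ⟨h3, hxm, h4⟩)
  · push Not at hst
    have hlog : ∀ n, n ∉ W.byz →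
        HonestLog P m {k | (ω k).1 ∈ W.byz} (X.honestSet W ω m) (X.log n u) := fun n hn =>
      hX.honestLog ht hT hδ hno hn hum List.prefix_rfl (hmono n hn) (hst n hn)
    rcases hu with ⟨n, hn, b, hb, hbs⟩ | ⟨n, n', hn, hn', f, hf, b', hb', hi⟩
    · exfalso
      have hl := hlog n hn
      have hbl : b ∈ X.log n u := by
        refine ((hl.sound.known b).1 (Or.inr (Or.inl hb))).resolve_left ?_
        rintro ⟨τ, rfl⟩
        exact absurd hbs.1 (not_le.2 (HonestChain.genesis_slot_lt τ))
      exact hst n hn b (Or.inr ⟨hbs, hl.slot_le b hbl, hX.eq_honestBlock hn hbl hbs⟩) hb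
    · exact (hlog n hn).bad_of_incompat_final (hlog n' hn') hH hE hf hb' hi

theorem nonneg_of_attackSuccess (hX : X.Admissible P W ω) (ht : 0 < P.t₀) {u : ℝ}
    (hu : X.AttackSuccess P W ω u) : 0 ≤ u := by
  by_contra hlt
  have hlog : ∀ n, n ∉ W.byz → X.log n u = [] := by
    intro n hn
    rw [List.eq_nil_iff_forall_not_mem]
    intro b hb
    have h1 := hX.log_time n hn u b hb
    have h2 := Params.slotTime_nonneg ht b.slot
    linarith
  rcases hu with ⟨n, hn, b, hb, -⟩ | ⟨n, _, hn, -, b, hb, -⟩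
  · simp [Trace.state, hlog n hn, nodeState, NodeState.init] at hb
  · simp [Trace.finals, Trace.state, hlog n hn, nodeState, NodeState.init] at hb

/-- The times of success need not have a minimum, so the slot interval is minimised instead; this is
enough because no slot begins inside an interval. -/
theorem exists_bad (hX : X.Admissible P W ω) (ht : 0 < P.t₀) (hT : 0 < T)
    (hE : P.E = 0) (hδ : W.δ < P.t₀ / 2) {U : ℝ} (hU : X.AttackSuccess P W ω U) :
    ∃ (m : ℕ) (u : ℝ), u ≤ U ∧ X.AttackSuccess P W ω u ∧ P.slotTime m ≤ u ∧
      u < P.slotTime (m + 1) ∧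
      Bad T m P.threshold (6 * T) {k | HonestSlot T W ω k ∧ k ≤ m} {k | (ω k).1 ∈ W.byz} := by
  have hex : ∃ m, ∃ u ≤ U, X.AttackSuccess P W ω u ∧ u < P.slotTime (m + 1) := by
    obtain ⟨k, hk⟩ := exists_nat_gt (U * T / P.t₀)
    refine ⟨k, U, le_rfl, hU, ?_⟩
    refine lt_of_lt_of_le ?_ (Params.slotTime_mono ht (Nat.le_succ k))
    exact not_le.1 fun h => absurd ((Params.slotTime_le_iff ht hT).1 h) (not_le.2 hk)
  have hmin : ∀ v ≤ U, v < P.slotTime (Nat.find hex) → ¬ X.AttackSuccess P W ω v := by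
    intro v hvU hv hs
    rcases hm : Nat.find hex with _ | k
    · rw [hm] at hv
      have := hX.nonneg_of_attackSuccess ht hs
      simp only [Params.slotTime, Nat.cast_zero, zero_mul, zero_div] at hv
      linarith
    · rw [hm] at hv
      exact Nat.find_min hex (m := k) (by omega) ⟨v, hvU, hs, hv⟩
  obtain ⟨u, huU, hus, hum⟩ := Nat.find_spec hex
  have hmu : P.slotTime (Nat.find hex) ≤ u := not_lt.1 fun h => hmin u huU h hus
  exact ⟨_, u, huU, hus, hmu, hum, hX.bad_of_first_success ht hT hE hδ
    (fun v hv => hmin v (hv.le.trans (hmu.trans huU)) hv) hmu hum hus⟩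

end Admissible

theorem attackSuccess_of_not_finalsCompat {n₁ n₂ : N} (h₁ : n₁ ∉ W.byz) (h₂ : n₂ ∉ W.byz) {u : ℝ}
    (h : ¬ X.FinalsCompat P n₁ n₂ u) : X.AttackSuccess P W ω u := by
  unfold FinalsCompat at h
  push Not at h
  obtain ⟨b₁, hb₁, b₂, hb₂, hi⟩ := h
  exact Or.inr ⟨n₁, n₂, h₁, h₂, b₁, hb₁, b₂, Or.inl hb₂, not_not.1 hi⟩

end Trace

end Executions

/-! ### Union bound over the interval of first success. -/

theorem selection_le_of_bad {T : ℕ} {N : Type*} [MeasurableSpace N] (W : Network N) {F c : ℕ}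
    {B : ℝ}
    (h : ∀ m, W.selection {ω | Bad T m F c {k | HonestSlot T W ω k ∧ k ≤ m}
      {k | (ω k).1 ∈ W.byz}} ≤ ENNReal.ofReal B) (I : Finset ℕ) {s : Set (ℕ → N × Bool)}
    (hs : ∀ ω ∈ s, ∃ m ∈ I, Bad T m F c {k | HonestSlot T W ω k ∧ k ≤ m}
      {k | (ω k).1 ∈ W.byz}) : W.selection s ≤ ENNReal.ofReal (I.card * B) := by
  calc W.selection s ≤ W.selection (⋃ m ∈ I, {ω | Bad T m F c
        {k | HonestSlot T W ω k ∧ k ≤ m} {k | (ω k).1 ∈ W.byz}}) := by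
        refine MeasureTheory.measure_mono fun ω hω => ?_
        obtain ⟨m, hm, hb⟩ := hs ω hω
        exact Set.mem_iUnion₂.2 ⟨m, hm, hb⟩
    _ ≤ ∑ m ∈ I, ENNReal.ofReal B :=
        (MeasureTheory.measure_biUnion_finset_le I _).trans (Finset.sum_le_sum fun m _ => h m)
    _ = ENNReal.ofReal (I.card * B) := by
        rw [Finset.sum_const, nsmul_eq_mul, ENNReal.ofReal_mul (Nat.cast_nonneg _),
          ENNReal.ofReal_natCast]

end Blockclique
theorem mainTheorem3 (T : ℕ) (hT : 0 < T) (β : ℝ) (hβ : 0 ≤ β) (μ : unitInterval)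
    (γ : ℝ) (hγ : γ = (1 - β) * (1 - (μ : ℝ))) (hβγ : β < γ) :
    ∃ C > (0 : ℝ), ∃ c > (0 : ℝ),
      ∀ (P : Blockclique.Params T), 0 < P.t₀ → 0 < P.SB → P.E = 0 →
      ∀ (N : Type*) [Fintype N] [MeasurableSpace N] [MeasurableSingletonClass N]
        (W : Blockclique.Network N), W.μ = μ → 0 ≤ W.δ → W.δ < P.t₀ / 2 →
        (∀ k, (W.resource k).toMeasure W.byz ≤ ENNReal.ofReal β) →
      ∀ n₁ n₂ : N, n₁ ∉ W.byz → n₂ ∉ W.byz → ∀ t r : ℝ, 0 < t → 0 < r →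
        W.selection {ω | ∃ X : Blockclique.Trace T N, X.Admissible P W ω ∧
            X.FinalsCompat P n₁ n₂ t ∧ ¬ X.FinalsCompat P n₁ n₂ (t + r)} ≤
          ENNReal.ofReal (C * (⌊(t + r) * T / P.t₀⌋₊ + 1) * Real.exp (-c * P.F)) ∧
        W.selection {ω | ∃ X : Blockclique.Trace T N, X.Admissible P W ω ∧
            (∀ u ≤ t, ¬ X.AttackSuccess P W ω u) ∧
            X.FinalsCompat P n₁ n₂ t ∧ ¬ X.FinalsCompat P n₁ n₂ (t + r)} ≤
          ENNReal.ofReal (C * (⌊r * T / P.t₀⌋₊ + 1) * Real.exp (-c * P.F)) := by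
  obtain ⟨C, hC, a, ha, hbad⟩ := Blockclique.exists_measure_bad_le T hβ μ (hγ ▸ hβγ)
    (c := 6 * T) (by omega)
  -- In the second part up to ⌊rT/t₀⌋ + 2 intervals occur; the factor 2 absorbs this.
  refine ⟨2 * C, by positivity, a, ha, ?_⟩
  intro P ht _ hE N _ _ _ W hμ _ hδ hW n₁ n₂ h₁ h₂ t r htpos hr
  have hthr : P.threshold = P.F := by simp [Blockclique.Params.threshold, hE]
  have hTr : (0 : ℝ) < T := by exact_mod_cast hT
  have hB := fun m => hbad N W hμ hW m P.F
  set B := C * Real.exp (-a * P.F) with hBdef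
  have hB0 : 0 ≤ B := by positivity
  have hexists : ∀ (ω : ℕ → N × Bool) (X : Blockclique.Trace T N), X.Admissible P W ω →
      ¬ X.FinalsCompat P n₁ n₂ (t + r) → ∃ (m : ℕ) (u : ℝ), X.AttackSuccess P W ω u ∧
        m ≤ ⌊(t + r) * T / P.t₀⌋₊ ∧ u * T / P.t₀ < m + 1 ∧
        Blockclique.Bad T m P.F (6 * T) {k | Blockclique.HonestSlot T W ω k ∧ k ≤ m}
          {k | (ω k).1 ∈ W.byz} := by
    intro ω X hX hf
    obtain ⟨m, u, h1, h2, h3, h4, h5⟩ := hX.exists_bad ht hT hE hδ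
      (Blockclique.Trace.attackSuccess_of_not_finalsCompat h₁ h₂ hf)
    refine ⟨m, u, h2, Nat.le_floor ?_, ?_, hthr ▸ h5⟩
    · exact (Blockclique.Params.slotTime_le_iff ht hT).1 (h3.trans h1)
    · rw [← not_le, Blockclique.Params.slotTime_le_iff ht hT] at h4
      push_cast at h4
      exact not_le.1 h4
  have hfin : ∀ (I : Finset ℕ) (q : ℝ), (I.card : ℝ) ≤ 2 * (q + 1) →
      ENNReal.ofReal (I.card * B) ≤ ENNReal.ofReal (2 * C * (q + 1) * Real.exp (-a * P.F)) := by
    intro I q hq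
    apply ENNReal.ofReal_le_ofReal
    calc (I.card : ℝ) * B ≤ 2 * (q + 1) * B := by gcongr
      _ = _ := by rw [hBdef]; ring
  constructor
  · refine (Blockclique.selection_le_of_bad W hB
      (Finset.range (⌊(t + r) * T / P.t₀⌋₊ + 1)) ?_).trans (hfin _ _ ?_)
    · rintro ω ⟨X, hX, -, hf⟩
      obtain ⟨m, u, -, h2, -, h4⟩ := hexists ω X hX hf
      exact ⟨m, Finset.mem_range.2 (by omega), h4⟩
    · rw [Finset.card_range]
      push_cast
      have : (0 : ℝ) ≤ ⌊(t + r) * T / P.t₀⌋₊ := Nat.cast_nonneg _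
      linarith
  · refine (Blockclique.selection_le_of_bad W hB
      (Finset.Icc ⌊t * T / P.t₀⌋₊ ⌊(t + r) * T / P.t₀⌋₊) ?_).trans (hfin _ _ ?_)
    · rintro ω ⟨X, hX, hno, -, hf⟩
      obtain ⟨m, u, h1, h2, h3, h4⟩ := hexists ω X hX hf
      refine ⟨m, Finset.mem_Icc.2 ⟨?_, h2⟩, h4⟩
      -- Success comes after `t`, so the interval of first success is not earlier than the one
      -- containing `t`.
      have htu : t < u := not_le.1 fun h => hno u h h1
      have h5 : t * T / P.t₀ < (m + 1 : ℕ) := by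
        push_cast
        refine lt_of_le_of_lt ?_ h3
        gcongr
      have := (Nat.floor_lt (by positivity)).2 h5
      omega
    · have h1 : ⌊(t + r) * T / P.t₀⌋₊ ≤ ⌊t * T / P.t₀⌋₊ + ⌊r * T / P.t₀⌋₊ + 1 := by
        rw [← Nat.lt_succ_iff, Nat.floor_lt (by positivity)]
        have e : (t + r) * T / P.t₀ = t * T / P.t₀ + r * T / P.t₀ := by ring
        have h2 := Nat.lt_floor_add_one (t * T / P.t₀)
        have h3 := Nat.lt_floor_add_one (r * T / P.t₀)
        rw [e]
        push_cast
        linarith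
      have h2 : (Finset.Icc ⌊t * T / P.t₀⌋₊ ⌊(t + r) * T / P.t₀⌋₊).card ≤
          2 * (⌊r * T / P.t₀⌋₊ + 1) := by
        rw [Nat.card_Icc]
        omega
      exact_mod_cast h2
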